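/- For a prime $p\in\{13,17,19\}$, $\tau$ in the upper half plane and $q=e^{2\pi i\tau}$, put $$E_{1,\chi}(\tau)=1+\frac{2}{L(0,\chi)}\sum_{n\ge 1}\chi(n)\frac{q^n}{1-q^n},\qquad \mathcal E_p(\tau)=\frac{2}{p-1}\sum_{\chi}E_{1,\chi}(\tau),$$ where $\chi$ runs over the odd primitive Dirichlet characters modulo $p$ and $L(s,\chi)$ is the analytically continued Dirichlet $L$-function. For $\gamma=\begin{pmatrix}\alpha&\beta\\ c&d\end{pmatrix}\in\Gamma_0(p)\subset SL_2(\mathbb Z)$ let $\langle\gamma\rangle(f)(\tau)=(c\tau+d)^{-1}f(\gamma\tau)$ (the diamond operator in weight one). For an integer $a$ prime to $p$ let $\mathcal E_{a,p}=\langle a\rangle(\mathcal E_p)=\langle\gamma_a\rangle(\mathcal E_p)$, where $\gamma_a\in\Gamma_0(p)$ is any matrix whose lower right entry is congruent to $a$ modulo $p$. Then, for every choice of the matrices $\gamma_a$, the following relations hold identically on the upper half plane. Level $13$ (three relations; $\mathcal E_a$ stands for $\mathcal E_{a,13}$): $$\mathcal E_{1}\mathcal E_{3}+\mathcal E_{2}\mathcal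 E_{3}-\mathcal E_{1}\mathcal E_{5}-\mathcal E_{1}\mathcal E_{7}-\mathcal E_{2}\mathcal E_{7}-\mathcal E_{5}\mathcal E_{7}=0$$ $$\mathcal E_{1}\mathcal E_{4}-\mathcal E_{1}\mathcal E_{5}+\mathcal E_{3}\mathcal E_{7}+\mathcal E_{4}\mathcal E_{7}-\mathcal E_{5}\mathcal E_{7}=0$$ $$\mathcal E_{3}\mathcal E_{5}-\mathcal E_{1}\mathcal E_{7}-\mathcal E_{3}\mathcal E_{7}=0$$ Level $17$ (six relations; $\mathcal E_a$ stands for $\mathcal E_{a,17}$): $$-3\mathcal E_{2}\mathcal E_{3}+2\mathcal E_{7}\mathcal E_{3}+3\mathcal E_{13}\mathcal E_{3}+\mathcal E_{2}\mathcal E_{7}+\mathcal E_{2}\mathcal E_{8}+3\mathcal E_{2}\mathcal E_{11}-3\mathcal E_{5}\mathcal E_{11}+3\mathcal E_{7}\mathcal E_{11}-\mathcal E_{2}\mathcal E_{13}-3\mathcal E_{7}\mathcal E_{13}-3\mathcal E_{11}\mathcal E_{13}=0$$ $$-9\mathcal E_{2}\mathcal E_{3}+5\mathcal E_{7}\mathcal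 E_{3}+9\mathcal E_{13}\mathcal E_{3}-5\mathcal E_{2}\mathcal E_{7}-5\mathcal E_{2}\mathcal E_{8}+9\mathcal E_{1}\mathcal E_{11}+9\mathcal E_{2}\mathcal E_{11}+9\mathcal E_{7}\mathcal E_{11}+5\mathcal E_{2}\mathcal E_{13}-9\mathcal E_{11}\mathcal E_{13}=0$$ $$-3\mathcal E_{1}\mathcal E_{5}-3\mathcal E_{7}\mathcal E_{5}+3\mathcal E_{1}\mathcal E_{7}+\mathcal E_{2}\mathcal E_{7}+2\mathcal E_{3}\mathcal E_{7}+\mathcal E_{2}\mathcal E_{8}-3\mathcal E_{2}\mathcal E_{11}-3\mathcal E_{7}\mathcal E_{11}+2\mathcal E_{2}\mathcal E_{13}=0$$ $$-9\mathcal E_{2}\mathcal E_{3}+7\mathcal E_{7}\mathcal E_{3}+9\mathcal E_{8}\mathcal E_{3}+2\mathcal E_{2}\mathcal E_{7}+2\mathcal E_{2}\mathcal E_{8}+9\mathcal E_{7}\mathcal E_{11}+7\mathcal E_{2}\mathcal E_{13}-9\mathcal E_{7}\mathcal E_{13}=0$$ $$16\mathcal E_{2}\mathcal E_{7}-16\mathcal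 E_{3}\mathcal E_{7}+9\mathcal E_{8}\mathcal E_{7}+9\mathcal E_{1}\mathcal E_{8}+16\mathcal E_{2}\mathcal E_{8}-9\mathcal E_{2}\mathcal E_{11}-7\mathcal E_{2}\mathcal E_{13}=0$$ $$\mathcal E_{2}\mathcal E_{7}-3\mathcal E_{3}\mathcal E_{5}+2\mathcal E_{3}\mathcal E_{7}+\mathcal E_{2}\mathcal E_{8}-\mathcal E_{2}\mathcal E_{13}-3\mathcal E_{7}\mathcal E_{13}=0$$ Level $19$ (ten relations; $\mathcal E_a$ stands for $\mathcal E_{a,19}$): $$\mathcal E_{2}\mathcal E_{5}-\mathcal E_{4}\mathcal E_{5}+\mathcal E_{7}\mathcal E_{5}-3\mathcal E_{9}\mathcal E_{5}+\mathcal E_{11}\mathcal E_{5}+\mathcal E_{13}\mathcal E_{5}+\mathcal E_{7}\mathcal E_{9}-\mathcal E_{7}\mathcal E_{11}-\mathcal E_{2}\mathcal E_{13}-\mathcal E_{3}\mathcal E_{13}+\mathcal E_{9}\mathcal E_{13}-\mathcal E_{11}\mathcal E_{13}=0$$ $$-\mathcal E_{1}\mathcal E_{5}+\mathcal E_{2}\mathcal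 E_{5}+\mathcal E_{3}\mathcal E_{5}-\mathcal E_{4}\mathcal E_{5}+\mathcal E_{7}\mathcal E_{5}-\mathcal E_{11}\mathcal E_{5}-\mathcal E_{13}\mathcal E_{5}+\mathcal E_{1}\mathcal E_{7}-\mathcal E_{2}\mathcal E_{13}-\mathcal E_{3}\mathcal E_{13}+\mathcal E_{11}\mathcal E_{13}=0$$ $$-\mathcal E_{2}\mathcal E_{5}-\mathcal E_{3}\mathcal E_{5}+\mathcal E_{7}\mathcal E_{5}-\mathcal E_{9}\mathcal E_{5}+\mathcal E_{11}\mathcal E_{5}+\mathcal E_{13}\mathcal E_{5}+\mathcal E_{2}\mathcal E_{7}-\mathcal E_{7}\mathcal E_{11}+\mathcal E_{2}\mathcal E_{13}-\mathcal E_{11}\mathcal E_{13}=0$$ $$\mathcal E_{2}\mathcal E_{5}+\mathcal E_{3}\mathcal E_{5}-\mathcal E_{7}\mathcal E_{5}-\mathcal E_{11}\mathcal E_{5}-\mathcal E_{13}\mathcal E_{5}+\mathcal E_{3}\mathcal E_{11}-\mathcal E_{2}\mathcal E_{13}-\mathcal E_{3}\mathcal E_{13}+\mathcal E_{11}\mathcal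 E_{13}=0$$ $$-\mathcal E_{2}\mathcal E_{5}-\mathcal E_{3}\mathcal E_{5}+\mathcal E_{7}\mathcal E_{5}+\mathcal E_{9}\mathcal E_{5}+\mathcal E_{13}\mathcal E_{5}+\mathcal E_{2}\mathcal E_{11}+\mathcal E_{3}\mathcal E_{13}-\mathcal E_{11}\mathcal E_{13}=0$$ $$-\mathcal E_{2}\mathcal E_{5}-\mathcal E_{3}\mathcal E_{5}+\mathcal E_{4}\mathcal E_{5}+\mathcal E_{9}\mathcal E_{5}+\mathcal E_{1}\mathcal E_{9}+\mathcal E_{2}\mathcal E_{13}+\mathcal E_{3}\mathcal E_{13}=0$$ $$-\mathcal E_{2}\mathcal E_{3}+\mathcal E_{5}\mathcal E_{3}+\mathcal E_{9}\mathcal E_{3}+\mathcal E_{2}\mathcal E_{5}-\mathcal E_{4}\mathcal E_{5}-\mathcal E_{2}\mathcal E_{13}=0$$ $$-\mathcal E_{3}\mathcal E_{5}-\mathcal E_{9}\mathcal E_{5}+\mathcal E_{13}\mathcal E_{5}+\mathcal E_{1}\mathcal E_{13}+\mathcal E_{3}\mathcal E_{13}=0$$ $$\mathcal E_{3}\mathcal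 E_{5}-\mathcal E_{4}\mathcal E_{5}+\mathcal E_{4}\mathcal E_{11}-\mathcal E_{3}\mathcal E_{13}=0$$ $$\mathcal E_{2}\mathcal E_{4}-\mathcal E_{5}\mathcal E_{9}-\mathcal E_{3}\mathcal E_{13}=0$$ -/

import Mathlib

open scoped MatrixGroups

noncomputable section

open UpperHalfPlane CongruenceSubgroup

/-- The nome `q = exp (2 π i τ)`. -/
def nome (τ : ℍ) : ℂ := Complex.exp (2 * Real.pi * Complex.I * (τ : ℂ))

/-- The Hecke Eisenstein series of weight `k ≥ 1` twisted by a Dirichlet character `χ` modulo `N`,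
`E_{k,χ}(τ) = 1 + 2 / L(1 - k, χ) * ∑_{n ≥ 1} χ(n) n^{k-1} q^n / (1 - q^n)`,
where `L(s, χ)` is the analytically continued Dirichlet `L`-function. -/
def heckeEisenstein {N : ℕ} [NeZero N] (k : ℕ) (χ : DirichletCharacter ℂ N) (τ : ℍ) : ℂ :=
  1 + 2 / DirichletCharacter.LFunction χ (1 - (k : ℂ)) *
    ∑' n : ℕ+, χ ((n : ℕ) : ZMod N) * (((n : ℕ) : ℂ) ^ (k - 1) * nome τ ^ (n : ℕ) /
      (1 - nome τ ^ (n : ℕ)))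

open scoped Classical in
/-- The normalized sum `𝓔_p = 2 / (p - 1) * ∑ E_{1,χ}` over the odd primitive Dirichlet characters
`χ` modulo `p`. -/
def eisensteinSum (p : ℕ) [NeZero p] (τ : ℍ) : ℂ :=
  2 / ((p : ℂ) - 1) *
    ∑ χ ∈ (Finset.univ : Finset (DirichletCharacter ℂ p)).filter
        (fun χ => χ.Odd ∧ χ.IsPrimitive),
      heckeEisenstein 1 χ τ

/-- The diamond operator `⟨γ⟩ f (τ) = (c τ + d)^{-k} f (γ τ)` in weight `k`, for
`γ = (a, b; c, d) ∈ Γ₀(N)`. -/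
def diamond {N : ℕ} (k : ℤ) (γ : Gamma0 N) (f : ℍ → ℂ) (τ : ℍ) : ℂ :=
  ((((γ : SL(2, ℤ)) 1 0 : ℤ) : ℂ) * (τ : ℂ) + (((γ : SL(2, ℤ)) 1 1 : ℤ) : ℂ)) ^ (-k) *
    f ((γ : SL(2, ℤ)) • τ)

/-- A choice, for every natural number `a` prime to `N`, of a matrix in `Γ₀(N)` whose lower right
entry is congruent to `a` modulo `N`. -/
def IsDiamondSystem (N : ℕ) (γ : ℕ → Gamma0 N) : Prop :=
  ∀ a : ℕ, a.Coprime N → (((γ a : SL(2, ℤ)) 1 1 : ℤ) : ZMod N) = (a : ZMod N)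

/-- The generators `𝓔_{a,p} = ⟨a⟩ 𝓔_p`, where `⟨a⟩` is computed with the representative `γ a`. -/
def eisensteinGen {p : ℕ} [NeZero p] (γ : ℕ → Gamma0 p) (a : ℕ) : ℍ → ℂ :=
  diamond 1 (γ a) (eisensteinSum p)

end

/-! To each nonzero residue class b modulo p belongs a weight one Eisenstein series s_b
(`levelEisenstein b`): up to an additive correction, it is the logarithmic derivative of a theta
function for the lattice spanned by 1 and pτ, evaluated at the torsion point bτ. The quadratic
relations come from the classical addition law (ζ(x)+ζ(y)+ζ(z))² = ℘(x)+℘(y)+℘(z) for x+y+z = 0.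
Here it says that s_a s_b - s_{a+b}(s_a + s_b) = w_a + w_b + w_{a+b}, where s is odd in b and w is
even (`levelEisenstein_threeTerm`). As q-series this is a partial fraction identity between
coefficients (`kroneckerCoeff_threeTerm`). A linear combination of these relations in which all the
w cancel is a quadratic relation among the s_b alone.

The s_b and the diamond translates of 𝓔_p are linked by Fourier analysis on the odd characters. On
one side, L(0,χ) E_{1,χ} = ∑ χ(b) s_b (`LFunction_zero_mul_heckeEisenstein`). On the other, L(0,χ) =
∑ χ(c)(1/2 - c/p) is nonzero, so inversion writes s_b as an explicit rational combination of the 𝓔_a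
(`levelEisenstein_eq_sum_oddEisenstein`). After substitution, the relations at levels 13, 17 and 19
are finite linear algebra.

The matrices γ_a enter only through modularity: Γ₀(p) permutes the s_b up to the automorphy factor
(`levelEisenstein_smul`), so E_{1,χ} has nebentypus χ and 𝓔_a depends only on a modulo p. This
follows from the transformation of theta under S and T, once `jacobiTheta₂'_eq_kroneckerSeries_mul`
and `jacobiTheta₂_ne_zero_of_im` identify the logarithmic derivative with the q-series. -/

/-- The coefficients of the Laurent expansion of `½ + ∑_{n ≠ 0} x ^ n / (1 - Q ^ n)`. -/
noncomputable def kroneckerCoeff (Q : ℂ) (n : ℤ) : ℂ := if n = 0 then 1 / 2 else 1 / (1 - Q ^ n)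

/-- The Laurent series `½ + ∑_{n ≠ 0} x ^ n / (1 - Q ^ n)` in the annulus `|Q| < |x| < 1`. -/
noncomputable def kroneckerSeries (Q x : ℂ) : ℂ := ∑' n : ℤ, kroneckerCoeff Q n * x ^ n

/-- The coefficients of the Laurent expansion of
`-1/12 + ∑_{n ≠ 0} Q ^ n x ^ n / (1 - Q ^ n) ^ 2`. -/
noncomputable def weierstrassCoeff (Q : ℂ) (n : ℤ) : ℂ :=
  if n = 0 then -1 / 12 else Q ^ n / (1 - Q ^ n) ^ 2

/-- The Laurent series `-1/12 + ∑_{n ≠ 0} Q ^ n x ^ n / (1 - Q ^ n) ^ 2` in the annulus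
`|Q| < |x| < |Q|⁻¹`. -/
noncomputable def weierstrassSeries (Q x : ℂ) : ℂ := ∑' n : ℤ, weierstrassCoeff Q n * x ^ n

/-! ### The Kronecker series: convergence, addition formula and reflection. -/

section KroneckerSeries

variable {Q : ℂ}

lemma one_sub_zpow_ne_zero (hQ1 : ‖Q‖ < 1) {n : ℤ} (hn : n ≠ 0) :
    1 - Q ^ n ≠ 0 := by
  intro h
  have h1 : ‖Q‖ ^ n = 1 := by rw [← norm_zpow, ← sub_eq_zero.mp h, norm_one]
  exact hn ((zpow_eq_one_iff_right₀ (norm_nonneg Q) hQ1.ne).mp h1)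

lemma norm_kroneckerCoeff_natCast_le (hQ1 : ‖Q‖ < 1) (n : ℕ) :
    ‖kroneckerCoeff Q n‖ ≤ 1 / (1 - ‖Q‖) := by
  have h0 : 0 < 1 - ‖Q‖ := by linarith
  unfold kroneckerCoeff
  split_ifs with h
  · have : ‖(1 / 2 : ℂ)‖ = 1 / 2 := by norm_num
    rw [this]
    exact one_div_le_one_div_of_le h0 (by linarith [norm_nonneg Q])
  · rw [norm_div, norm_one, zpow_natCast]
    refine one_div_le_one_div_of_le h0 ?_
    have h1 : ‖Q ^ n‖ ≤ ‖Q‖ := by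
      rw [norm_pow]
      exact pow_le_of_le_one (norm_nonneg _) hQ1.le (by exact_mod_cast h)
    have := norm_sub_norm_le (1 : ℂ) (Q ^ n)
    rw [norm_one] at this
    linarith

lemma kroneckerCoeff_neg (hQ1 : ‖Q‖ < 1) (hQ0 : Q ≠ 0) {n : ℤ} (hn : n ≠ 0) :
    kroneckerCoeff Q (-n) = -(Q ^ n * kroneckerCoeff Q n) := by
  have h1 := one_sub_zpow_ne_zero hQ1 hn
  have h2 := one_sub_zpow_ne_zero hQ1 (neg_ne_zero.mpr hn)
  have h3 : Q ^ n ≠ 0 := zpow_ne_zero _ hQ0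
  simp only [kroneckerCoeff, hn, neg_eq_zero, if_false]
  rw [zpow_neg] at h2 ⊢
  generalize Q ^ n = M at *
  have h4 : M - 1 ≠ 0 := fun h ↦ h1 (by linear_combination -h)
  have e : 1 - M⁻¹ = (M - 1) / M := by field_simp
  rw [e]
  field_simp
  ring

lemma norm_kroneckerCoeff_le (hQ1 : ‖Q‖ < 1) (hQ0 : Q ≠ 0) (n : ℤ) :
    ‖kroneckerCoeff Q n‖ ≤ 1 / (1 - ‖Q‖) := by
  obtain ⟨m, rfl | rfl⟩ := n.eq_nat_or_neg
  · exact norm_kroneckerCoeff_natCast_le hQ1 m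
  · rcases eq_or_ne m 0 with rfl | hm
    · simpa using norm_kroneckerCoeff_natCast_le hQ1 0
    · rw [kroneckerCoeff_neg hQ1 hQ0 (by exact_mod_cast hm), norm_neg, norm_mul, zpow_natCast,
        norm_pow]
      calc _ ≤ 1 * ‖kroneckerCoeff Q m‖ := by
            gcongr
            exact pow_le_one₀ (norm_nonneg _) hQ1.le
        _ ≤ _ := by rw [one_mul]; exact norm_kroneckerCoeff_natCast_le hQ1 m

lemma summable_norm_kroneckerCoeff_mul_zpow (hQ0 : Q ≠ 0) {x : ℂ} (hx1 : ‖x‖ < 1)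
    (hQx : ‖Q‖ < ‖x‖) : Summable fun n : ℤ ↦ ‖kroneckerCoeff Q n * x ^ n‖ := by
  have hQ1 : ‖Q‖ < 1 := hQx.trans hx1
  have hx0 : 0 < ‖x‖ := (norm_nonneg _).trans_lt hQx
  have hr : ‖Q‖ / ‖x‖ < 1 := (div_lt_one hx0).mpr hQx
  refine Summable.of_nat_of_neg ?_ ?_
  · refine Summable.of_nonneg_of_le (fun _ ↦ norm_nonneg _) (fun n ↦ ?_)
      ((summable_geometric_of_lt_one (norm_nonneg x) hx1).mul_left (1 / (1 - ‖Q‖)))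
    rw [norm_mul, zpow_natCast, norm_pow]
    gcongr
    exact norm_kroneckerCoeff_natCast_le hQ1 n
  · refine Summable.of_nonneg_of_le (fun _ ↦ norm_nonneg _) (fun n ↦ ?_)
      ((summable_geometric_of_lt_one (by positivity) hr).mul_left (1 / (1 - ‖Q‖)))
    rcases eq_or_ne n 0 with rfl | hn
    · simpa using norm_kroneckerCoeff_natCast_le hQ1 0
    · rw [kroneckerCoeff_neg hQ1 hQ0 (by exact_mod_cast hn), zpow_neg, norm_mul, norm_neg, norm_mul,
        norm_inv, zpow_natCast, zpow_natCast, norm_pow, norm_pow, div_pow]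
      have := norm_kroneckerCoeff_natCast_le hQ1 n
      calc _ = ‖kroneckerCoeff Q n‖ * (‖Q‖ ^ n / ‖x‖ ^ n) := by ring
        _ ≤ _ := by gcongr

/-- The product form makes the symmetry in `n` visible and reduces every convergence question to the
Kronecker coefficients. -/
lemma weierstrassCoeff_eq (hQ1 : ‖Q‖ < 1) (hQ0 : Q ≠ 0) {n : ℤ} (hn : n ≠ 0) :
    weierstrassCoeff Q n = -(kroneckerCoeff Q (-n) * kroneckerCoeff Q n) := by
  have h1 := one_sub_zpow_ne_zero hQ1 hn
  rw [kroneckerCoeff_neg hQ1 hQ0 hn]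
  simp only [kroneckerCoeff, weierstrassCoeff, hn, if_false]
  field_simp

lemma weierstrassCoeff_neg (hQ1 : ‖Q‖ < 1) (hQ0 : Q ≠ 0) (n : ℤ) :
    weierstrassCoeff Q (-n) = weierstrassCoeff Q n := by
  rcases eq_or_ne n 0 with rfl | hn
  · simp
  · rw [weierstrassCoeff_eq hQ1 hQ0 hn, weierstrassCoeff_eq hQ1 hQ0 (neg_ne_zero.mpr hn), neg_neg,
      mul_comm]

lemma norm_weierstrassCoeff_le (hQ1 : ‖Q‖ < 1) (hQ0 : Q ≠ 0) (n : ℤ) :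
    ‖weierstrassCoeff Q n‖ ≤ 1 / (1 - ‖Q‖) * ‖kroneckerCoeff Q n‖ := by
  rcases eq_or_ne n 0 with rfl | hn
  · have h0 : 1 ≤ 1 / (1 - ‖Q‖) :=
      (one_le_div (by linarith)).mpr (by linarith [norm_nonneg Q])
    simp only [weierstrassCoeff, kroneckerCoeff, if_true]
    norm_num at h0 ⊢
    linarith
  · rw [weierstrassCoeff_eq hQ1 hQ0 hn, norm_neg, norm_mul]
    gcongr
    exact norm_kroneckerCoeff_le hQ1 hQ0 _

lemma summable_norm_weierstrassCoeff_mul_zpow (hQ0 : Q ≠ 0) {x : ℂ} (hx1 : ‖x‖ < 1)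
    (hQx : ‖Q‖ < ‖x‖) : Summable fun n : ℤ ↦ ‖weierstrassCoeff Q n * x ^ n‖ := by
  refine Summable.of_nonneg_of_le (fun _ ↦ norm_nonneg _) (fun n ↦ ?_)
    ((summable_norm_kroneckerCoeff_mul_zpow hQ0 hx1 hQx).mul_left (1 / (1 - ‖Q‖)))
  rw [norm_mul, norm_mul, ← mul_assoc]
  gcongr
  exact norm_weierstrassCoeff_le (hQx.trans hx1) hQ0 n

lemma hasSum_kroneckerSeries (hQ0 : Q ≠ 0) {x : ℂ} (hx1 : ‖x‖ < 1) (hQx : ‖Q‖ < ‖x‖) :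
    HasSum (fun n : ℤ ↦ kroneckerCoeff Q n * x ^ n) (kroneckerSeries Q x) :=
  (summable_norm_kroneckerCoeff_mul_zpow hQ0 hx1 hQx).of_norm.hasSum

lemma hasSum_weierstrassSeries (hQ0 : Q ≠ 0) {x : ℂ} (hx1 : ‖x‖ < 1) (hQx : ‖Q‖ < ‖x‖) :
    HasSum (fun n : ℤ ↦ weierstrassCoeff Q n * x ^ n) (weierstrassSeries Q x) :=
  (summable_norm_weierstrassCoeff_mul_zpow hQ0 hx1 hQx).of_norm.hasSum

/-- The partial fraction identity behind the addition formula of `kroneckerSeries`. -/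
lemma kroneckerCoeff_threeTerm (hQ1 : ‖Q‖ < 1) (hQ0 : Q ≠ 0) (m n : ℤ) :
    kroneckerCoeff Q m * kroneckerCoeff Q n - kroneckerCoeff Q n * kroneckerCoeff Q (m - n)
      - kroneckerCoeff Q m * kroneckerCoeff Q (n - m) =
    (if n = 0 then weierstrassCoeff Q m else 0) + (if m = 0 then weierstrassCoeff Q n else 0)
      + (if m = n then weierstrassCoeff Q m else 0) := by
  rcases eq_or_ne n 0 with rfl | hn
  · rcases eq_or_ne m 0 with rfl | hm
    -- All three delta terms are active here, against 1/4 - 1/4 - 1/4 on the left. This forces the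
    -- constant -1/12.
    · simp only [kroneckerCoeff, weierstrassCoeff, sub_zero, if_true]
      norm_num
    · rw [zero_sub, sub_zero, weierstrassCoeff_eq hQ1 hQ0 hm]
      simp only [hm, if_true, if_false]
      ring
  · rcases eq_or_ne m 0 with rfl | hm
    · rw [zero_sub, sub_zero, weierstrassCoeff_eq hQ1 hQ0 hn]
      simp only [hn, hn.symm, if_true, if_false]
      ring
    · have h1 := one_sub_zpow_ne_zero hQ1 hm
      have h2 := one_sub_zpow_ne_zero hQ1 hn
      rcases eq_or_ne m n with rfl | hmn
      -- The constant term 1/2 is what turns the left side into K² - K, with K = 1/(1 - Q^m), which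
      -- equals Q^m/(1 - Q^m)².
      · simp only [hm, sub_self, kroneckerCoeff, weierstrassCoeff, if_true, if_false]
        field_simp
        ring
      · have h3 := one_sub_zpow_ne_zero hQ1 (sub_ne_zero.mpr hmn)
        have h4 := one_sub_zpow_ne_zero hQ1 (sub_ne_zero.mpr hmn.symm)
        have hM : Q ^ m ≠ 0 := zpow_ne_zero _ hQ0
        have hN : Q ^ n ≠ 0 := zpow_ne_zero _ hQ0
        simp only [hm, hn, hmn, sub_ne_zero.mpr hmn, sub_ne_zero.mpr hmn.symm, kroneckerCoeff,
          if_false, add_zero]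
        rw [zpow_sub₀ hQ0] at h3 h4 ⊢
        rw [zpow_sub₀ hQ0]
        generalize Q ^ m = M at *
        generalize Q ^ n = N at *
        have h5 : N - M ≠ 0 := fun h ↦ h3 (by field_simp; linear_combination h)
        have h6 : M - N ≠ 0 := fun h ↦ h4 (by field_simp; linear_combination h)
        -- Off the axes and the diagonal no correction remains: with M = Q^m and N = Q^n, the
        -- product 1/((1 - M)(1 - N)) is exactly the sum of 1/((1 - N)(1 - M/N)) and 1/((1 - M)(1 -
        -- N/M)).
        have e3 : 1 - M / N = (N - M) / N := by field_simp
        have e4 : 1 - N / M = -((N - M) / M) := by field_simp; ring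
        rw [e3, e4]
        field_simp
        ring

lemma hasSum_mul_of_summable_norm {ι κ : Type*} {f : ι → ℂ} {g : κ → ℂ} {a b : ℂ}
    (hf : HasSum f a) (hg : HasSum g b) (hf' : Summable fun i ↦ ‖f i‖)
    (hg' : Summable fun i ↦ ‖g i‖) : HasSum (fun p : ι × κ ↦ f p.1 * g p.2) (a * b) := by
  have h := hf.mul hg (summable_mul_of_summable_norm hf' hg')
  exact h

lemma hasSum_kroneckerSeries_mul (hQ0 : Q ≠ 0) {x y : ℂ} (hx1 : ‖x‖ < 1) (hQx : ‖Q‖ < ‖x‖)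
    (hy1 : ‖y‖ < 1) (hQy : ‖Q‖ < ‖y‖) :
    HasSum (fun p : ℤ × ℤ ↦ kroneckerCoeff Q p.1 * x ^ p.1 * (kroneckerCoeff Q p.2 * y ^ p.2))
      (kroneckerSeries Q x * kroneckerSeries Q y) :=
  hasSum_mul_of_summable_norm (f := fun n : ℤ ↦ kroneckerCoeff Q n * x ^ n)
    (g := fun n : ℤ ↦ kroneckerCoeff Q n * y ^ n) (hasSum_kroneckerSeries hQ0 hx1 hQx)
    (hasSum_kroneckerSeries hQ0 hy1 hQy) (summable_norm_kroneckerCoeff_mul_zpow hQ0 hx1 hQx)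
    (summable_norm_kroneckerCoeff_mul_zpow hQ0 hy1 hQy)

/-- The addition formula: the Kronecker series satisfies a three-term quadratic relation. -/
theorem kroneckerSeries_threeTerm (hQ0 : Q ≠ 0) {x y : ℂ} (hx : ‖x‖ < 1) (hy : ‖y‖ < 1)
    (hxy : ‖Q‖ < ‖x * y‖) :
    kroneckerSeries Q x * kroneckerSeries Q y
      - kroneckerSeries Q (x * y) * (kroneckerSeries Q x + kroneckerSeries Q y) =
    weierstrassSeries Q x + weierstrassSeries Q y + weierstrassSeries Q (x * y) := by
  have hQx : ‖Q‖ < ‖x‖ := hxy.trans_le (by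
    rw [norm_mul]; exact mul_le_of_le_one_right (norm_nonneg _) hy.le)
  have hQy : ‖Q‖ < ‖y‖ := hxy.trans_le (by
    rw [norm_mul]; exact mul_le_of_le_one_left (norm_nonneg _) hx.le)
  have hxy1 : ‖x * y‖ < 1 := by
    rw [norm_mul]; exact mul_lt_one_of_nonneg_of_lt_one_left (norm_nonneg _) hx hy.le
  have hQ1 : ‖Q‖ < 1 := hQx.trans hx
  have hx0 : x ≠ 0 := norm_pos_iff.mp ((norm_nonneg _).trans_lt hQx)
  have hy0 : y ≠ 0 := norm_pos_iff.mp ((norm_nonneg _).trans_lt hQy)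
  -- The equivalences reindex the two products containing the series at `x * y`, so that the index
  -- (m, n) always collects the monomial x^m y^n.
  obtain ⟨e₁, he₁⟩ : ∃ e : ℤ × ℤ ≃ ℤ × ℤ, ∀ p, e p = (p.2, p.1 - p.2) :=
    ⟨⟨fun p ↦ (p.2, p.1 - p.2), fun p ↦ (p.1 + p.2, p.1), fun p ↦ by simp, fun p ↦ by simp⟩,
      fun _ ↦ rfl⟩
  obtain ⟨e₂, he₂⟩ : ∃ e : ℤ × ℤ ≃ ℤ × ℤ, ∀ p, e p = (p.1, p.2 - p.1) :=
    ⟨⟨fun p ↦ (p.1, p.2 - p.1), fun p ↦ (p.1, p.1 + p.2), fun p ↦ by simp, fun p ↦ by simp⟩,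
      fun _ ↦ rfl⟩
  have H := ((hasSum_kroneckerSeries_mul hQ0 hx hQx hy hQy).sub
    (e₁.hasSum_iff.mpr (hasSum_kroneckerSeries_mul hQ0 hxy1 hxy hx hQx))).sub
    (e₂.hasSum_iff.mpr (hasSum_kroneckerSeries_mul hQ0 hxy1 hxy hy hQy))
  -- The right-hand series are double sums supported on the two axes and on the diagonal.
  have inj₁ : Function.Injective fun m : ℤ ↦ (m, (0 : ℤ)) := fun a b h ↦ (Prod.ext_iff.mp h).1
  have inj₂ : Function.Injective fun m : ℤ ↦ ((0 : ℤ), m) := fun a b h ↦ (Prod.ext_iff.mp h).2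
  have inj₃ : Function.Injective fun m : ℤ ↦ (m, m) := fun a b h ↦ (Prod.ext_iff.mp h).1
  have B₁ : HasSum (fun p : ℤ × ℤ ↦ if p.2 = 0 then weierstrassCoeff Q p.1 * x ^ p.1 else 0)
      (weierstrassSeries Q x) := by
    refine (inj₁.hasSum_iff fun p hp ↦ if_neg fun h ↦ hp ⟨p.1, by ext <;> simp [h]⟩).mp ?_
    simpa [Function.comp_def] using hasSum_weierstrassSeries hQ0 hx hQx
  have B₂ : HasSum (fun p : ℤ × ℤ ↦ if p.1 = 0 then weierstrassCoeff Q p.2 * y ^ p.2 else 0)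
      (weierstrassSeries Q y) := by
    refine (inj₂.hasSum_iff fun p hp ↦ if_neg fun h ↦ hp ⟨p.2, by ext <;> simp [h]⟩).mp ?_
    simpa [Function.comp_def] using hasSum_weierstrassSeries hQ0 hy hQy
  have B₃ : HasSum (fun p : ℤ × ℤ ↦ if p.1 = p.2 then weierstrassCoeff Q p.1 * (x * y) ^ p.1 else 0)
      (weierstrassSeries Q (x * y)) := by
    refine (inj₃.hasSum_iff fun p hp ↦ if_neg fun h ↦ hp ⟨p.1, by ext <;> simp [h]⟩).mp ?_
    simpa [Function.comp_def] using hasSum_weierstrassSeries hQ0 hxy1 hxy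
  have key : kroneckerSeries Q x * kroneckerSeries Q y
      - kroneckerSeries Q (x * y) * kroneckerSeries Q x
      - kroneckerSeries Q (x * y) * kroneckerSeries Q y =
    weierstrassSeries Q x + weierstrassSeries Q y + weierstrassSeries Q (x * y) := by
    refine H.unique (((B₁.add B₂).add B₃).congr_fun fun p ↦ ?_)
    obtain ⟨m, n⟩ := p
    have h := congr_arg (· * (x ^ m * y ^ n)) (kroneckerCoeff_threeTerm hQ1 hQ0 m n)
    simp only [Function.comp_apply, he₁, he₂]
    have t₁ : (x * y) ^ n * x ^ (m - n) = x ^ m * y ^ n := by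
      rw [mul_zpow, mul_right_comm, ← zpow_add₀ hx0]; congr 2; ring
    have t₂ : (x * y) ^ m * y ^ (n - m) = x ^ m * y ^ n := by
      rw [mul_zpow, mul_assoc, ← zpow_add₀ hy0]; congr 2; ring
    have s₁ : (if n = 0 then weierstrassCoeff Q m * x ^ m else 0) =
        (if n = 0 then weierstrassCoeff Q m else 0) * (x ^ m * y ^ n) := by
      split_ifs with h <;> simp [h]
    have s₂ : (if m = 0 then weierstrassCoeff Q n * y ^ n else 0) =
        (if m = 0 then weierstrassCoeff Q n else 0) * (x ^ m * y ^ n) := by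
      split_ifs with h <;> simp [h]
    have s₃ : (if m = n then weierstrassCoeff Q m * (x * y) ^ m else 0) =
        (if m = n then weierstrassCoeff Q m else 0) * (x ^ m * y ^ n) := by
      split_ifs with h <;> simp [h, mul_zpow]
    rw [s₁, s₂, s₃]
    linear_combination h - kroneckerCoeff Q n * kroneckerCoeff Q (m - n) * t₁
      - kroneckerCoeff Q m * kroneckerCoeff Q (n - m) * t₂
  linear_combination key

lemma norm_div_lt_one_of_lt {x : ℂ} (hQx : ‖Q‖ < ‖x‖) : ‖Q / x‖ < 1 := by
  rw [norm_div, div_lt_one ((norm_nonneg _).trans_lt hQx)]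
  exact hQx

lemma lt_norm_div_of_lt_one (hQ0 : Q ≠ 0) {x : ℂ} (hx0 : x ≠ 0) (hx1 : ‖x‖ < 1) :
    ‖Q‖ < ‖Q / x‖ := by
  rw [norm_div, lt_div_iff₀ (norm_pos_iff.mpr hx0)]
  exact mul_lt_of_lt_one_right (norm_pos_iff.mpr hQ0) hx1

/-- Reversing the index turns the coefficient of x^n into its negative for n ≠ 0, while the constant
term stays 1/2 = 1 - 1/2. This is the source of the oddness of the Eisenstein series. -/
lemma kroneckerSeries_div (hQ0 : Q ≠ 0) {x : ℂ} (hx1 : ‖x‖ < 1) (hQx : ‖Q‖ < ‖x‖) :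
    kroneckerSeries Q (Q / x) = 1 - kroneckerSeries Q x := by
  have hx0 : x ≠ 0 := norm_pos_iff.mp ((norm_nonneg _).trans_lt hQx)
  have h := (Equiv.neg ℤ).hasSum_iff.mpr
    (hasSum_kroneckerSeries hQ0 (norm_div_lt_one_of_lt hQx) (lt_norm_div_of_lt_one hQ0 hx0 hx1))
  refine h.unique (((hasSum_ite_eq (0 : ℤ) (1 : ℂ)).sub
    (hasSum_kroneckerSeries hQ0 hx1 hQx)).congr_fun fun n ↦ ?_)
  rcases eq_or_ne n 0 with rfl | hn
  · simp only [Function.comp_apply, Equiv.neg_apply, neg_zero, kroneckerCoeff, if_true, zpow_zero]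
    norm_num
  · have hM : Q ^ n ≠ 0 := zpow_ne_zero _ hQ0
    simp only [Function.comp_apply, Equiv.neg_apply, hn, if_false]
    rw [kroneckerCoeff_neg (hQx.trans hx1) hQ0 hn, div_zpow, zpow_neg, zpow_neg]
    field_simp
    ring

/-- For n ≠ 0 the reflected coefficient is 1/(1 - Q^n)² = Q^n/(1 - Q^n)² + 1/(1 - Q^n). The final
-1/2 removes the constant term of the Kronecker series. -/
lemma weierstrassSeries_div (hQ0 : Q ≠ 0) {x : ℂ} (hx1 : ‖x‖ < 1) (hQx : ‖Q‖ < ‖x‖) :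
    weierstrassSeries Q (Q / x) = weierstrassSeries Q x + kroneckerSeries Q x - 1 / 2 := by
  have hx0 : x ≠ 0 := norm_pos_iff.mp ((norm_nonneg _).trans_lt hQx)
  have h := (Equiv.neg ℤ).hasSum_iff.mpr
    (hasSum_weierstrassSeries hQ0 (norm_div_lt_one_of_lt hQx) (lt_norm_div_of_lt_one hQ0 hx0 hx1))
  refine h.unique ((((hasSum_weierstrassSeries hQ0 hx1 hQx).add
    (hasSum_kroneckerSeries hQ0 hx1 hQx)).sub (hasSum_ite_eq (0 : ℤ) (1 / 2 : ℂ))).congr_fun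
      fun n ↦ ?_)
  rcases eq_or_ne n 0 with rfl | hn
  · simp [kroneckerCoeff]
  · have hM : Q ^ n ≠ 0 := zpow_ne_zero _ hQ0
    have h1 := one_sub_zpow_ne_zero (hQx.trans hx1) hn
    simp only [Function.comp_apply, Equiv.neg_apply, hn, if_false]
    rw [weierstrassCoeff_neg (hQx.trans hx1) hQ0, div_zpow, zpow_neg, zpow_neg]
    simp only [kroneckerCoeff, weierstrassCoeff, hn, if_false]
    field_simp
    ring

end KroneckerSeries

/-! ### The logarithmic derivative of theta. -/

section Theta

open Complex

/-- The shift by half periods places the zero of theta at u = 0 and turns the terms into (-1)^n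
Q^{n(n-1)/2} X^n. -/
lemma jacobiTheta₂_term_shift (n : ℤ) (u τ : ℂ) :
    jacobiTheta₂_term n (u - 1 / 2 - τ / 2) τ =
      (-1) ^ n * cexp (Real.pi * I * (n * (n - 1)) * τ) * cexp (2 * Real.pi * I * u) ^ n := by
  have h : (-1 : ℂ) ^ n = cexp (-(Real.pi * I) * n) := by
    rw [mul_comm, Complex.exp_int_mul, Complex.exp_neg, exp_pi_mul_I]
    norm_num
  rw [jacobiTheta₂_term, h, ← Complex.exp_int_mul, ← Complex.exp_add, ← Complex.exp_add]
  congr 1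
  ring

lemma jacobiTheta₂_term_shift_succ (n : ℤ) (u τ : ℂ) :
    jacobiTheta₂_term (n + 1) (u - 1 / 2 - τ / 2) τ =
      -(cexp (2 * Real.pi * I * u) * cexp (2 * Real.pi * I * τ) ^ n) *
        jacobiTheta₂_term n (u - 1 / 2 - τ / 2) τ := by
  rw [jacobiTheta₂_term_shift, jacobiTheta₂_term_shift, zpow_add_one₀ (by norm_num),
    zpow_add_one₀ (Complex.exp_ne_zero _), ← Complex.exp_int_mul (2 * Real.pi * I * τ)]
  have : cexp (Real.pi * I * ((n + 1 : ℤ) * ((n + 1 : ℤ) - 1)) * τ) =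
      cexp (n * (2 * Real.pi * I * τ)) * cexp (Real.pi * I * (n * (n - 1)) * τ) := by
    rw [← Complex.exp_add]
    congr 1
    push_cast
    ring
  rw [this]
  ring

/-- The exponent n(n - 1) is invariant under n ↦ 1 - n while the sign changes. Pairing terms this
way gives the vanishing of theta at u = 0. -/
lemma jacobiTheta₂_term_shift_one_sub (n : ℤ) (u τ : ℂ) :
    cexp (2 * Real.pi * I * u) ^ n * jacobiTheta₂_term (1 - n) (u - 1 / 2 - τ / 2) τ =
      -(cexp (2 * Real.pi * I * u) ^ (1 - n) * jacobiTheta₂_term n (u - 1 / 2 - τ / 2) τ) := by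
  rw [jacobiTheta₂_term_shift, jacobiTheta₂_term_shift]
  have h1 : cexp (Real.pi * I * ((1 - n : ℤ) * ((1 - n : ℤ) - 1)) * τ) =
      cexp (Real.pi * I * (n * (n - 1)) * τ) := by
    congr 1
    push_cast
    ring
  have h2 : (-1 : ℂ) ^ (1 - n) = -(-1) ^ n := by
    rw [zpow_sub₀ (by norm_num), zpow_one]
    rcases Int.even_or_odd n with h | h <;> simp [h.neg_one_zpow]
  rw [h1, h2]
  ring

lemma jacobiTheta₂_term_shift_neg (n : ℤ) (u τ : ℂ) :
    cexp (2 * Real.pi * I * u) ^ n * jacobiTheta₂_term (-n) (u - 1 / 2 - τ / 2) τ =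
      cexp (2 * Real.pi * I * τ) ^ n *
        (cexp (2 * Real.pi * I * u) ^ (-n) * jacobiTheta₂_term n (u - 1 / 2 - τ / 2) τ) := by
  rw [jacobiTheta₂_term_shift, jacobiTheta₂_term_shift, ← Complex.exp_int_mul (2 * Real.pi * I * τ)]
  have h1 : cexp (Real.pi * I * ((-n : ℤ) * ((-n : ℤ) - 1)) * τ) =
      cexp (n * (2 * Real.pi * I * τ)) * cexp (Real.pi * I * (n * (n - 1)) * τ) := by
    rw [← Complex.exp_add]
    congr 1
    push_cast
    ring
  have h2 : (-1 : ℂ) ^ (-n) = (-1) ^ n := by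
    rcases Int.even_or_odd n with h | h <;> simp [h.neg_one_zpow]
  rw [h1, h2]
  ring

lemma norm_cexp_two_pi_I_mul (z : ℂ) :
    ‖cexp (2 * Real.pi * I * z)‖ = Real.exp (-(2 * Real.pi * z.im)) := by
  rw [Complex.norm_exp]
  congr 1
  simp

lemma norm_cexp_two_pi_I_mul_lt_one {z : ℂ} (hz : 0 < z.im) :
    ‖cexp (2 * Real.pi * I * z)‖ < 1 := by
  rw [norm_cexp_two_pi_I_mul, Real.exp_lt_one_iff, neg_lt_zero]
  positivity

lemma norm_cexp_two_pi_I_mul_lt {z w : ℂ} (h : w.im < z.im) :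
    ‖cexp (2 * Real.pi * I * z)‖ < ‖cexp (2 * Real.pi * I * w)‖ := by
  rw [norm_cexp_two_pi_I_mul, norm_cexp_two_pi_I_mul, Real.exp_lt_exp]
  have := Real.pi_pos
  nlinarith

/-- The logarithmic derivative of the shifted theta function is the Kronecker series. -/
theorem jacobiTheta₂'_eq_kroneckerSeries_mul {u τ : ℂ} (hu : 0 < u.im) (huτ : u.im < τ.im) :
    jacobiTheta₂' (u - 1 / 2 - τ / 2) τ = 2 * Real.pi * I *
      (1 / 2 - kroneckerSeries (cexp (2 * Real.pi * I * τ)) (cexp (2 * Real.pi * I * u))) *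
        jacobiTheta₂ (u - 1 / 2 - τ / 2) τ := by
  have hτ : 0 < τ.im := hu.trans huτ
  set Q := cexp (2 * Real.pi * I * τ) with hQ
  set X := cexp (2 * Real.pi * I * u) with hX
  set z := u - 1 / 2 - τ / 2 with hz
  have hQ0 : Q ≠ 0 := Complex.exp_ne_zero _
  have hX0 : X ≠ 0 := Complex.exp_ne_zero _
  have hQ1 : ‖Q‖ < 1 := norm_cexp_two_pi_I_mul_lt_one hτ
  have hX1 : ‖X‖ < 1 := norm_cexp_two_pi_I_mul_lt_one hu
  have hQX : ‖Q‖ < ‖X‖ := norm_cexp_two_pi_I_mul_lt huτ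
  have hθ := hasSum_jacobiTheta₂_term z hτ
  obtain ⟨e, he⟩ : ∃ e : ℤ × ℤ ≃ ℤ × ℤ, ∀ p, e p = (p.2, p.1 - p.2) :=
    ⟨⟨fun p ↦ (p.2, p.1 - p.2), fun p ↦ (p.1 + p.2, p.1), fun p ↦ by simp, fun p ↦ by simp⟩,
      fun _ ↦ rfl⟩
  have H := e.hasSum_iff.mpr (hasSum_mul_of_summable_norm (f := fun n : ℤ ↦ kroneckerCoeff Q n * X ^ n)
    (g := fun n : ℤ ↦ jacobiTheta₂_term n z τ) (hasSum_kroneckerSeries hQ0 hX1 hQX) hθ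
    (summable_norm_kroneckerCoeff_mul_zpow hQ0 hX1 hQX) hθ.summable.norm)
  have hS (n : ℤ) : Summable fun k : ℤ ↦
      kroneckerCoeff Q k * X ^ k * jacobiTheta₂_term (n - k) z τ :=
    (H.summable.prod_factor n).congr fun k ↦ by simp only [Function.comp_apply, he]
  -- `S n` is the degree n part in X of the product of the Kronecker series with theta. The goal is
  -- S n = (1/2 - n) times the n-th theta term, which compares the product with the derivative term
  -- by term.
  set S : ℤ → ℂ := fun n ↦ ∑' k : ℤ, kroneckerCoeff Q k * X ^ k * jacobiTheta₂_term (n - k) z τ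
  -- By the recursion of the theta terms, adding the shifted S multiplies each coefficient by 1 -
  -- Q^k. This clears the denominator for k ≠ 0 and kills the term k = 0.
  have hU (n : ℤ) : HasSum (fun k : ℤ ↦ X ^ k * jacobiTheta₂_term (n - k) z τ -
      if k = 0 then jacobiTheta₂_term n z τ else 0) (S n + X * Q ^ (n - 1) * S (n - 1)) := by
    refine ((hS n).hasSum.add ((hS (n - 1)).hasSum.mul_left (X * Q ^ (n - 1)))).congr_fun fun k ↦ ?_
    have h := jacobiTheta₂_term_shift_succ (n - 1 - k) u τ
    rw [← hX, ← hQ, ← hz, show n - 1 - k + 1 = n - k by ring, zpow_sub₀ hQ0] at h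
    rcases eq_or_ne k 0 with rfl | hk
    · simp only [kroneckerCoeff, if_true, zpow_zero, sub_zero, div_one] at h ⊢
      linear_combination (-1 / 2) * h
    · have h1 := one_sub_zpow_ne_zero hQ1 hk
      have h2 : Q ^ k ≠ 0 := zpow_ne_zero _ hQ0
      simp only [kroneckerCoeff, hk, if_false]
      field_simp at h ⊢
      linear_combination -X ^ k * h
  -- This sum is X^n times theta at u = 0. The involution k ↦ 2n - 1 - k changes the sign of the
  -- terms.
  have hU0 (n : ℤ) : ∑' k : ℤ, X ^ k * jacobiTheta₂_term (n - k) z τ = 0 := by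
    have h1 := (Equiv.subLeft (2 * n - 1)).tsum_eq (fun k : ℤ ↦ X ^ k * jacobiTheta₂_term (n - k) z τ)
    have h2 (k : ℤ) : X ^ (2 * n - 1 - k) * jacobiTheta₂_term (n - (2 * n - 1 - k)) z τ =
        -(X ^ k * jacobiTheta₂_term (n - k) z τ) := by
      have h3 := jacobiTheta₂_term_shift_one_sub (n - k) u τ
      rw [← hX, ← hz, show 1 - (n - k) = n - (2 * n - 1 - k) by ring] at h3
      have e1 : X ^ (2 * n - 1 - k) = X ^ (n - 1) * X ^ (n - k) := by
        rw [← zpow_add₀ hX0]; congr 1; ring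
      have e2 : X ^ k = X ^ (n - 1) * X ^ (n - (2 * n - 1 - k)) := by
        rw [← zpow_add₀ hX0]; congr 1; ring
      rw [e1, e2]
      linear_combination X ^ (n - 1) * h3
    simp only [Equiv.subLeft_apply, h2, tsum_neg] at h1
    linear_combination (-1 / 2) * h1
  have hrec (n : ℤ) : S n + X * Q ^ (n - 1) * S (n - 1) = -jacobiTheta₂_term n z τ := by
    have h1 := hasSum_ite_eq (0 : ℤ) (jacobiTheta₂_term n z τ)
    have h2 : Summable fun k : ℤ ↦ X ^ k * jacobiTheta₂_term (n - k) z τ :=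
      ((hU n).add h1).summable.congr fun k ↦ by ring
    have h3 := (h2.hasSum.sub h1).unique (hU n)
    rw [← h3, hU0, zero_sub]
  -- The terms k and -k cancel, leaving only the constant coefficient 1/2. This anchors the
  -- first-order recursion `hrec`.
  have hS0 : S 0 = 1 / 2 * jacobiTheta₂_term 0 z τ := by
    have h1 := (Equiv.neg ℤ).hasSum_iff.mpr (hS 0).hasSum
    have h2 : HasSum (fun k : ℤ ↦ if k = 0 then jacobiTheta₂_term 0 z τ else 0) (S 0 + S 0) := by
      refine ((hS 0).hasSum.add h1).congr_fun fun k ↦ ?_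
      rcases eq_or_ne k 0 with rfl | hk
      · simp [kroneckerCoeff]
        ring
      · have h3 := jacobiTheta₂_term_shift_neg k u τ
        rw [← hX, ← hQ, ← hz] at h3
        simp only [Function.comp_apply, Equiv.neg_apply, hk, if_false, zero_sub, neg_neg]
        rw [kroneckerCoeff_neg hQ1 hQ0 hk]
        linear_combination -kroneckerCoeff Q k * h3
    have h3 := h2.unique (hasSum_ite_eq (0 : ℤ) (jacobiTheta₂_term 0 z τ))
    linear_combination (1 / 2) * h3
  have hSn (n : ℤ) : S n = (1 / 2 - n) * jacobiTheta₂_term n z τ := by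
    induction n using Int.induction_on with
    | zero => rw [hS0]; simp
    | succ n ih =>
      have h1 := hrec (n + 1)
      have h2 := jacobiTheta₂_term_shift_succ n u τ
      rw [← hX, ← hQ, ← hz] at h2
      rw [add_sub_cancel_right, ih] at h1
      push_cast at h1 ⊢
      linear_combination h1 - (1 / 2 - (n : ℂ)) * h2
    | pred n ih =>
      have h1 := hrec (-n)
      have h2 := jacobiTheta₂_term_shift_succ (-n - 1) u τ
      rw [← hX, ← hQ, ← hz, sub_add_cancel] at h2
      rw [ih] at h1
      have h3 : X * Q ^ (-(n : ℤ) - 1) ≠ 0 := mul_ne_zero hX0 (zpow_ne_zero _ hQ0)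
      refine mul_left_cancel₀ h3 ?_
      push_cast at h1 ⊢
      linear_combination h1 - (3 / 2 + (n : ℂ)) * h2
  have hfinal : HasSum (fun n : ℤ ↦ (1 / 2 - (n : ℂ)) * jacobiTheta₂_term n z τ)
      (kroneckerSeries Q X * jacobiTheta₂ z τ) := by
    refine (H.prod_fiberwise fun n ↦ ?_)
    rw [← hSn]
    exact (hS n).hasSum.congr_fun fun k ↦ by simp only [Function.comp_apply, he]
  have h1 := (((hθ.mul_left (1 / 2)).sub hfinal).mul_left (2 * Real.pi * I)).congr_fun
    (g := fun n ↦ jacobiTheta₂'_term n z τ) fun n ↦ by rw [jacobiTheta₂'_term]; ring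
  rw [(hasSum_jacobiTheta₂'_term z hτ).unique h1]
  ring

end Theta

/-! ### Nonvanishing of theta away from the lattice. -/

section ThetaNonvanishing

open Complex

/-- Extracts the zeroth Fourier coefficient; a function vanishing on a horizontal line must
therefore have this coefficient equal to zero. -/
lemma hasSum_integral_fourier_of_summable_norm {c : ℤ → ℂ} (hc : Summable fun n ↦ ‖c n‖) :
    ∫ x in (0 : ℝ)..1, ∑' n : ℤ, c n * cexp (2 * Real.pi * I * n * x) = c 0 := by
  let f : ℤ → C(ℝ, ℂ) := fun n ↦ ⟨fun x ↦ c n * cexp (2 * Real.pi * I * n * x), by fun_prop⟩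
  have h := intervalIntegral.hasSum_intervalIntegral_of_summable_norm
    (a := 0) (b := 1) (f := f) (by
      refine Summable.of_nonneg_of_le (fun _ ↦ norm_nonneg _) (fun n ↦ ?_) hc
      rw [ContinuousMap.norm_le _ (norm_nonneg _)]
      rintro ⟨x, -⟩
      simp only [f, ContinuousMap.restrict_apply, ContinuousMap.coe_mk, norm_mul, Complex.norm_exp]
      simp)
  refine (h.unique ?_)
  refine (hasSum_ite_eq (0 : ℤ) (c 0)).congr_fun fun n ↦ ?_
  simp only [f, ContinuousMap.coe_mk]
  rcases eq_or_ne n 0 with rfl | hn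
  · simp
  · have hn' : 2 * Real.pi * I * n ≠ 0 := by
      simp [Real.pi_ne_zero, hn]
    rw [intervalIntegral.integral_const_mul, integral_exp_mul_complex hn', if_neg hn]
    have : cexp (2 * Real.pi * I * n * (1 : ℝ)) = 1 := by
      rw [Complex.exp_eq_one_iff]
      exact ⟨n, by push_cast; ring⟩
    rw [this]
    simp

/-- The shifted theta function does not vanish strictly inside the period strip. -/
theorem jacobiTheta₂_ne_zero_of_im {u τ : ℂ} (hu : 0 < u.im) (huτ : u.im < τ.im) :
    jacobiTheta₂ (u - 1 / 2 - τ / 2) τ ≠ 0 := by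
  intro h0
  have hτ : 0 < τ.im := hu.trans huτ
  set Q := cexp (2 * Real.pi * I * τ) with hQ
  set z := u - 1 / 2 - τ / 2 with hz
  set X : ℝ → ℂ := fun t ↦ cexp (2 * Real.pi * I * (u + t)) with hX
  have hnorm (t : ℝ) : ‖X t‖ = ‖X 0‖ := by
    simp only [hX, norm_cexp_two_pi_I_mul]
    simp
  have hsum := summable_norm_kroneckerCoeff_mul_zpow (Complex.exp_ne_zero _)
    (norm_cexp_two_pi_I_mul_lt_one hu) (norm_cexp_two_pi_I_mul_lt huτ)
  set M : ℝ := ∑' n : ℤ, ‖kroneckerCoeff Q n * cexp (2 * Real.pi * I * u) ^ n‖ with hM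
  have hZ (t : ℝ) : ‖kroneckerSeries Q (X t)‖ ≤ M := by
    have e (n : ℤ) : ‖kroneckerCoeff Q n * X t ^ n‖ =
        ‖kroneckerCoeff Q n * cexp (2 * Real.pi * I * u) ^ n‖ := by
      rw [norm_mul, norm_zpow, hnorm, norm_mul, norm_zpow]
      simp [hX]
    rw [hM, ← tsum_congr e]
    exact norm_tsum_le_tsum_norm (hsum.congr fun n ↦ (e n).symm)
  -- Along the horizontal line through z, theta solves the linear equation y' = v(t, y). Its
  -- coefficient is bounded because |X t| is constant, so a single zero would force theta to vanish
  -- on the whole line.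
  set v : ℝ → ℂ → ℂ := fun t y ↦ 2 * Real.pi * I * (1 / 2 - kroneckerSeries Q (X t)) * y with hv
  set K : NNReal := ⟨2 * Real.pi * (1 / 2 + M), by
    have : 0 ≤ M := tsum_nonneg fun _ ↦ norm_nonneg _
    have := Real.pi_pos
    positivity⟩ with hK
  have hlip (t : ℝ) : LipschitzOnWith K (v t) Set.univ := by
    refine LipschitzWith.lipschitzOnWith (LipschitzWith.of_dist_le_mul fun y y' ↦ ?_)
    rw [dist_eq_norm, dist_eq_norm, hv]
    simp only
    rw [← mul_sub, norm_mul]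
    refine mul_le_mul_of_nonneg_right ?_ (norm_nonneg _)
    have h1 : ‖(2 * Real.pi * I : ℂ)‖ = 2 * Real.pi := by
      simp [abs_of_pos Real.pi_pos]
    rw [norm_mul, h1]
    change _ ≤ 2 * Real.pi * (1 / 2 + M)
    have := Real.pi_pos
    gcongr
    refine (norm_sub_le _ _).trans (add_le_add ?_ (hZ t))
    norm_num
  have hder (t : ℝ) : HasDerivAt (fun t : ℝ ↦ jacobiTheta₂ (z + t) τ)
      (v t (jacobiTheta₂ (z + t) τ)) t ∧ jacobiTheta₂ (z + t) τ ∈ (Set.univ : Set ℂ) := by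
    refine ⟨?_, Set.mem_univ _⟩
    have h1 := hasDerivAt_jacobiTheta₂_fst (z + t) hτ
    have h2 : HasDerivAt (fun t : ℝ ↦ z + (t : ℂ)) 1 t := by
      simpa using (hasDerivAt_id t).ofReal_comp.const_add z
    have h3 := h1.comp t h2
    have hut : (u + t).im = u.im := by simp
    have h4 := jacobiTheta₂'_eq_kroneckerSeries_mul (u := u + t) (τ := τ) (by rwa [hut]) (by rwa [hut])
    rw [show u + t - 1 / 2 - τ / 2 = z + t by rw [hz]; ring] at h4
    rw [mul_one, h4] at h3
    exact h3
  have hzero : (fun t : ℝ ↦ jacobiTheta₂ (z + t) τ) = fun _ ↦ 0 := by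
    refine ODE_solution_unique_univ (t₀ := 0) hlip hder (fun t ↦ ⟨?_, Set.mem_univ _⟩) ?_
    · simpa [hv] using hasDerivAt_const t (0 : ℂ)
    · simpa using h0
  have h1 := hasSum_integral_fourier_of_summable_norm (hasSum_jacobiTheta₂_term z hτ).summable.norm
  have h2 (x : ℝ) : ∑' n : ℤ, jacobiTheta₂_term n z τ * cexp (2 * Real.pi * I * n * x) = 0 := by
    rw [← congr_fun hzero x, jacobiTheta₂]
    refine tsum_congr fun n ↦ ?_
    rw [jacobiTheta₂_term, jacobiTheta₂_term, ← Complex.exp_add]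
    congr 1
    ring
  simp only [h2, intervalIntegral.integral_zero] at h1
  -- The zeroth Fourier coefficient is the theta term n = 0, which is 1.
  simp [jacobiTheta₂_term] at h1

end ThetaNonvanishing

/-! ### Weight one Eisenstein series at torsion points and their modularity. -/

section TorsionEisenstein

open Complex

/-- The weight one Eisenstein series attached to the point `r τ + s`, as a logarithmic derivative
of the theta function. It is modular of weight one in `τ` up to the action on `(r, s)`. -/
noncomputable def torsionEisenstein (r s : ℝ) (τ : ℂ) : ℂ :=
  1 / 2 - jacobiTheta₂' (r * τ + s - 1 / 2 - τ / 2) τ /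
    (2 * Real.pi * I * jacobiTheta₂ (r * τ + s - 1 / 2 - τ / 2) τ) - r

/-- The pair `(r, s)` does not lie in `ℤ × ℤ`. -/
def IsNonintegral (r s : ℝ) : Prop := ∀ m n : ℤ, r = m → s ≠ n

lemma jacobiTheta₂_add_one_mul (r s : ℝ) (τ : ℂ) :
    jacobiTheta₂ ((r + 1 : ℝ) * τ + s - 1 / 2 - τ / 2) τ =
      cexp (-Real.pi * I * (τ + 2 * (r * τ + s - 1 / 2 - τ / 2))) *
        jacobiTheta₂ (r * τ + s - 1 / 2 - τ / 2) τ := by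
  rw [← jacobiTheta₂_add_left']
  congr 1
  push_cast
  ring

lemma jacobiTheta₂_ne_zero_of_not_int {r : ℝ} (hr : ∀ m : ℤ, r ≠ m) (s : ℝ) {τ : ℂ}
    (hτ : 0 < τ.im) : jacobiTheta₂ (r * τ + s - 1 / 2 - τ / 2) τ ≠ 0 := by
  have hper : Function.Periodic
      (fun r : ℝ ↦ jacobiTheta₂ (r * τ + s - 1 / 2 - τ / 2) τ ≠ 0) 1 := by
    intro r
    simp only [jacobiTheta₂_add_one_mul, ne_eq, mul_eq_zero, Complex.exp_ne_zero, false_or]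
  have h1 := hper.sub_int_mul_eq (x := r) ⌊r⌋
  simp only [mul_one] at h1
  rw [← h1]
  have h2 : 0 < r - ⌊r⌋ := sub_pos.mpr (lt_of_le_of_ne (Int.floor_le r) (hr _).symm)
  have h3 : r - ⌊r⌋ < 1 := by linarith [Int.lt_floor_add_one r]
  have him : (((r - ⌊r⌋ : ℝ) : ℂ) * τ + s).im = (r - ⌊r⌋) * τ.im := by
    simp only [add_im, ofReal_im, add_zero, im_ofReal_mul]
  refine jacobiTheta₂_ne_zero_of_im (u := ((r - ⌊r⌋ : ℝ) : ℂ) * τ + s) ?_ ?_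
  · rw [him]; positivity
  · rw [him]; nlinarith

/-- Under S the point (r, s) becomes (1 - s, r) and not (-s, r), because the half-period shift is
also transformed. -/
lemma div_sub_eq_swap (r s : ℝ) {τ : ℂ} (hτ : τ ≠ 0) :
    (r * τ + s - 1 / 2 - τ / 2) / τ =
      ((1 - s : ℝ) : ℂ) * (-1 / τ) + (r : ℝ) - 1 / 2 - (-1 / τ) / 2 := by
  push_cast
  field_simp
  ring

lemma ne_zero_of_im_pos {τ : ℂ} (hτ : 0 < τ.im) : τ ≠ 0 := by
  rintro rfl
  simp at hτ

lemma neg_one_div_im_pos {τ : ℂ} (hτ : 0 < τ.im) : 0 < (-1 / τ).im := by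
  rw [neg_div, neg_im, one_div, inv_im, neg_div, neg_neg]
  exact div_pos hτ (normSq_pos.mpr (ne_zero_of_im_pos hτ))

/-- If r is an integer then s is not, and the functional equation under S exchanges their roles. -/
lemma jacobiTheta₂_ne_zero_of_isNonintegral {r s : ℝ} (h : IsNonintegral r s) {τ : ℂ}
    (hτ : 0 < τ.im) : jacobiTheta₂ (r * τ + s - 1 / 2 - τ / 2) τ ≠ 0 := by
  by_cases hr : ∃ m : ℤ, r = m
  · obtain ⟨m, hm⟩ := hr
    have h1 : ∀ n : ℤ, 1 - s ≠ n := fun n hn ↦ h m (1 - n) hm (by push_cast; linarith)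
    have hτ0 := ne_zero_of_im_pos hτ
    have h2 := jacobiTheta₂_ne_zero_of_not_int h1 r (neg_one_div_im_pos hτ)
    rw [jacobiTheta₂_functional_equation, div_sub_eq_swap r s hτ0]
    refine mul_ne_zero (mul_ne_zero (one_div_ne_zero ?_) (Complex.exp_ne_zero _)) h2
    exact (cpow_ne_zero_iff_of_exponent_ne_zero (by norm_num)).mpr (by simp [hτ0])
  · exact jacobiTheta₂_ne_zero_of_not_int (fun m hm ↦ hr ⟨m, hm⟩) s hτ

lemma torsionEisenstein_add_one_right (r s : ℝ) (τ : ℂ) :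
    torsionEisenstein r (s + 1) τ = torsionEisenstein r s τ := by
  have : (r : ℂ) * τ + ((s + 1 : ℝ) : ℂ) - 1 / 2 - τ / 2 =
      (r * τ + s - 1 / 2 - τ / 2) + 1 := by push_cast; ring
  rw [torsionEisenstein, this, jacobiTheta₂_add_left, jacobiTheta₂'_add_left, torsionEisenstein]

/-- The quasi-periodicity factor of theta contributes 1 to the logarithmic derivative term; the
summand -r in the definition is there to absorb it. -/
lemma torsionEisenstein_add_one_left {r s : ℝ} (h : IsNonintegral r s) {τ : ℂ} (hτ : 0 < τ.im) :
    torsionEisenstein (r + 1) s τ = torsionEisenstein r s τ := by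
  have e : ((r + 1 : ℝ) : ℂ) * τ + s - 1 / 2 - τ / 2 =
      (r * τ + s - 1 / 2 - τ / 2) + τ := by push_cast; ring
  have h0 := jacobiTheta₂_ne_zero_of_isNonintegral h hτ
  rw [torsionEisenstein, e, jacobiTheta₂_add_left', jacobiTheta₂'_add_left', torsionEisenstein]
  have h1 := Complex.exp_ne_zero (-Real.pi * I * (τ + 2 * (r * τ + s - 1 / 2 - τ / 2)))
  have h2 : (Real.pi : ℂ) ≠ 0 := by exact_mod_cast Real.pi_ne_zero
  generalize jacobiTheta₂ (r * τ + s - 1 / 2 - τ / 2) τ = A at *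
  generalize cexp (-Real.pi * I * (τ + 2 * (r * τ + s - 1 / 2 - τ / 2))) = B at *
  push_cast
  field_simp
  ring

lemma IsNonintegral.swap {r s : ℝ} (h : IsNonintegral r s) : IsNonintegral (-s) r :=
  fun m n hm hn ↦ h n (-m) hn (by push_cast; linarith)

/-- The Gaussian factor exp(-πi z²/τ) adds a term linear in z to the logarithmic derivative. The
summand -r and the constant 1/2 cancel it exactly. -/
lemma torsionEisenstein_neg_one_div {r s : ℝ} (h : IsNonintegral r s) {τ : ℂ} (hτ : 0 < τ.im) :
    torsionEisenstein (-s) r (-1 / τ) = τ * torsionEisenstein r s τ := by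
  have hτ0 := ne_zero_of_im_pos hτ
  rw [← torsionEisenstein_add_one_left h.swap (neg_one_div_im_pos hτ), torsionEisenstein,
    torsionEisenstein, show -s + 1 = 1 - s by ring, ← div_sub_eq_swap r s hτ0]
  have h0 := jacobiTheta₂_ne_zero_of_isNonintegral h hτ
  have h2 : (Real.pi : ℂ) ≠ 0 := by exact_mod_cast Real.pi_ne_zero
  have f1 := jacobiTheta₂_functional_equation (r * τ + s - 1 / 2 - τ / 2) τ
  have f2 := jacobiTheta₂'_functional_equation (r * τ + s - 1 / 2 - τ / 2) τ
  rw [f1] at h0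
  rw [f1, f2]
  obtain ⟨h3, h4⟩ := mul_ne_zero_iff.mp h0
  generalize jacobiTheta₂ ((r * τ + s - 1 / 2 - τ / 2) / τ) (-1 / τ) = A at *
  generalize jacobiTheta₂' ((r * τ + s - 1 / 2 - τ / 2) / τ) (-1 / τ) = A' at *
  generalize 1 / (-I * τ) ^ (1 / 2 : ℂ) *
    cexp (-Real.pi * I * (r * τ + s - 1 / 2 - τ / 2) ^ 2 / τ) = B at *
  push_cast
  field_simp
  ring

/-- As n² ≡ n modulo 2, replacing τ by τ + 1 in a theta term amounts to a shift of z by 1/2. -/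
lemma torsionEisenstein_add_one_tau (r s : ℝ) (τ : ℂ) :
    torsionEisenstein r s (τ + 1) = torsionEisenstein r (r + s) τ := by
  have e : (r : ℂ) * (τ + 1) + s - 1 / 2 - (τ + 1) / 2 + 1 =
      (r * τ + ((r + s : ℝ) : ℂ) - 1 / 2 - τ / 2) + 1 / 2 := by push_cast; ring
  have t (n : ℤ) (z : ℂ) : jacobiTheta₂_term n (z + 1 / 2) (τ + 1) = jacobiTheta₂_term n (z + 1) τ := by
    rw [jacobiTheta₂_term, jacobiTheta₂_term]
    obtain ⟨k, hk⟩ : Even (n * (n - 1)) := Int.even_mul_pred_self n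
    rw [Complex.exp_eq_exp_iff_exists_int]
    refine ⟨k, ?_⟩
    have : (n : ℂ) * (n - 1) = k + k := by exact_mod_cast hk
    linear_combination Real.pi * I * this
  have t1 (z : ℂ) : jacobiTheta₂ (z + 1 / 2) (τ + 1) = jacobiTheta₂ z τ := by
    rw [← jacobiTheta₂_add_left z τ]
    exact tsum_congr fun n ↦ t n z
  have t2 (z : ℂ) : jacobiTheta₂' (z + 1 / 2) (τ + 1) = jacobiTheta₂' z τ := by
    rw [← jacobiTheta₂'_add_left z τ]
    exact tsum_congr fun n ↦ by rw [jacobiTheta₂'_term, jacobiTheta₂'_term, t]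
  rw [torsionEisenstein, torsionEisenstein, ← jacobiTheta₂_add_left, ← jacobiTheta₂'_add_left, e,
    t1, t2]

open UpperHalfPlane ModularGroup

lemma IsNonintegral.smul {r s : ℝ} (h : IsNonintegral r s) (γ : SL(2, ℤ)) :
    IsNonintegral (r * γ 0 0 + s * γ 1 0) (r * γ 0 1 + s * γ 1 1) := by
  intro m n hm hn
  have hdet : ((γ 0 0 : ℤ) : ℝ) * γ 1 1 - γ 0 1 * γ 1 0 = 1 := by
    have := γ.det_coe
    rw [Matrix.det_fin_two] at this
    exact_mod_cast this
  refine h (m * γ 1 1 - n * γ 1 0) (n * γ 0 0 - m * γ 0 1) ?_ ?_ <;> push_cast <;>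
    rw [← hm, ← hn]
  · linear_combination (-r) * hdet
  · linear_combination (-s) * hdet

/-- The weight one transformation law of `torsionEisenstein`. -/
theorem torsionEisenstein_smul (γ : SL(2, ℤ)) {r s : ℝ} (h : IsNonintegral r s) (τ : ℍ) :
    torsionEisenstein r s (γ • τ : ℍ) =
      denom γ τ * torsionEisenstein (r * γ 0 0 + s * γ 1 0) (r * γ 0 1 + s * γ 1 1) τ := by
  have hγ : γ ∈ Subgroup.closure {S, T} := by
    simp [SpecialLinearGroup.SL2Z_generators]
  have cocycle (g g' : SL(2, ℤ)) (z : ℍ) : denom (g * g' : SL(2, ℤ)) z =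
      denom g (g' • z : ℍ) * denom g' z := by
    have := denom_cocycle_σ (g : GL (Fin 2) ℝ) g' z
    simpa [σ] using this
  have row (g g' : SL(2, ℤ)) (r s : ℝ) (j : Fin 2) :
      r * ((g * g' : SL(2, ℤ)) 0 j : ℤ) + s * ((g * g' : SL(2, ℤ)) 1 j : ℤ) =
        (r * g 0 0 + s * g 1 0) * g' 0 j + (r * g 0 1 + s * g 1 1) * g' 1 j := by
    simp only [Matrix.SpecialLinearGroup.coe_mul, Matrix.mul_apply, Fin.sum_univ_two]
    push_cast
    ring
  induction hγ using Subgroup.closure_induction generalizing r s τ with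
  | one => simp
  | mem g hg =>
    rcases hg with rfl | rfl
    · have h1 := torsionEisenstein_neg_one_div (r := s) (s := -r)
        (by simpa using h.swap.swap.swap) τ.im_pos
      rw [modular_S_smul, denom_S]
      simp only [S, Matrix.of_apply, neg_neg] at h1 ⊢
      simpa [neg_div, inv_neg] using h1
    · have h1 := torsionEisenstein_add_one_tau r s τ
      rw [modular_T_smul, denom_apply]
      simpa [T, add_comm] using h1
  | mul g g' _ _ ih ih' =>
    rw [mul_smul, ih h, ih' (h.smul g), cocycle, row, row, mul_assoc]
  | inv g _ ih =>
    have h1 := ih (h.smul g⁻¹) (g⁻¹ • τ)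
    rw [← row, ← row, inv_mul_cancel, smul_inv_smul] at h1
    have h2 : denom g (g⁻¹ • τ : ℍ) * denom (g⁻¹ : SL(2, ℤ)) τ = 1 := by
      rw [← cocycle, mul_inv_cancel]
      simp
    have e (i j : Fin 2) : (1 : SL(2, ℤ)) i j = if i = j then 1 else 0 := by
      rw [Matrix.SpecialLinearGroup.coe_one, Matrix.one_apply]
    simp only [e, zero_ne_one, one_ne_zero, if_true, if_false, Int.cast_one, Int.cast_zero, mul_one,
      mul_zero, add_zero, zero_add] at h1
    rw [h1, ← mul_assoc, mul_comm (denom (g⁻¹ : SL(2, ℤ)) _), h2, one_mul]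

end TorsionEisenstein

/-! ### The values L(0, χ): explicit formula and nonvanishing. -/

section LValue

open Complex Asymptotics Filter Topology Set

lemma isBigO_exp_sub_linear (c : ℂ) :
    (fun t : ℝ ↦ cexp (-c * t) - 1 + c * t) =O[𝓝[>] 0] fun t : ℝ ↦ t ^ 2 := by
  have h := Complex.exp_sub_sum_range_isBigO_pow 2
  have ht : Tendsto (fun t : ℝ ↦ -c * (t : ℂ)) (𝓝[>] 0) (𝓝 0) := by
    have : Continuous fun t : ℝ ↦ -c * (t : ℂ) := by fun_prop
    simpa using (this.tendsto 0).mono_left nhdsWithin_le_nhds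
  refine ((h.comp_tendsto ht).congr_left fun t ↦ ?_).trans ?_
  · simp [Finset.sum_range_succ]
    ring
  · refine IsBigO.of_bound (‖c‖ ^ 2) (Eventually.of_forall fun t ↦ ?_)
    simp [mul_pow]

/-- The numerator of the generating function `∑ n, (f n - c δ_{n,1}) e ^ {-n t}` of a function `f`
on `ℤ/N`, where `c` is such that the generating function vanishes at `t = 0`. -/
noncomputable def expSumNumerator {N : ℕ} (f : ZMod N → ℂ) (c : ℂ) (t : ℝ) : ℂ :=
  ∑ n ∈ Finset.range N, f n * cexp (-n * t) - c * (1 - cexp (-N * t)) * cexp (-(1 : ℕ) * t)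

variable {N : ℕ} [NeZero N] {f : ZMod N → ℂ}

lemma ZMod.sum_eq_sum_range {M : Type*} [AddCommMonoid M] (g : ZMod N → M) :
    ∑ j, g j = ∑ n ∈ Finset.range N, g n :=
  Finset.sum_nbij' (fun j ↦ j.val) (fun n ↦ (n : ZMod N))
    (fun j _ ↦ Finset.mem_range.mpr j.val_lt) (fun _ _ ↦ Finset.mem_univ _)
    (fun j _ ↦ ZMod.natCast_zmod_val j)
    (fun n hn ↦ ZMod.val_cast_of_lt (Finset.mem_range.mp hn))
    (fun j _ ↦ by rw [ZMod.natCast_zmod_val])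

lemma one_sub_cexp_neg_mul_ne_zero (N : ℕ) [NeZero N] {t : ℝ} (ht : 0 < t) :
    1 - cexp (-N * t) ≠ 0 := by
  intro h
  have h1 : ‖cexp (-N * t)‖ = 1 := by rw [← sub_eq_zero.mp h, norm_one]
  rw [Complex.norm_exp, Real.exp_eq_one_iff] at h1
  have : (0 : ℝ) < N := by exact_mod_cast NeZero.pos N
  simp at h1
  rcases h1 with h1 | h1
  · exact NeZero.ne N h1
  · exact ht.ne' h1

lemma ZMod.exists_norm_le (f : ZMod N → ℂ) : ∃ M, ∀ j, ‖f j‖ ≤ M := by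
  obtain ⟨j, hj⟩ := Finite.exists_max fun j ↦ ‖f j‖
  exact ⟨_, hj⟩

lemma hasSum_expSum (f : ZMod N → ℂ) (c : ℂ) {t : ℝ} (ht : 0 < t) :
    HasSum (fun n : ℕ ↦ (f n - if n = 1 then c else 0) * (Real.exp (-n * t) : ℂ))
      (expSumNumerator f c t / (1 - cexp (-N * t))) := by
  have hr : Real.exp (-t) < 1 := by simpa using ht
  have hd := one_sub_cexp_neg_mul_ne_zero N ht
  have hs : Summable fun n : ℕ ↦ f n * cexp (-n * t) := by
    obtain ⟨M, hM⟩ := ZMod.exists_norm_le f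
    refine Summable.of_norm_bounded
      ((summable_geometric_of_lt_one (Real.exp_pos _).le hr).mul_left M) fun n ↦ ?_
    rw [norm_mul, Complex.norm_exp, ← Real.exp_nat_mul]
    have e : (-(n : ℂ) * t).re = n * -t := by simp
    rw [e]
    gcongr
    exact hM _
  have h1 : ∑' n : ℕ, f n * cexp (-n * t) =
      (∑ n ∈ Finset.range N, f n * cexp (-n * t)) / (1 - cexp (-N * t)) := by
    rw [eq_div_iff hd]
    have h2 := hs.sum_add_tsum_nat_add N
    have h3 (n : ℕ) : f (n + N : ℕ) * cexp (-(n + N : ℕ) * t) =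
        f n * cexp (-n * t) * cexp (-N * t) := by
      rw [mul_assoc, ← Complex.exp_add]
      simp
      left
      ring_nf
    rw [tsum_congr h3, tsum_mul_right] at h2
    linear_combination -h2
  have h4 := hs.hasSum.sub (hasSum_ite_eq (1 : ℕ) (c * cexp (-(1 : ℕ) * t)))
  have h5 : expSumNumerator f c t / (1 - cexp (-N * t)) =
      ∑' n : ℕ, f n * cexp (-n * t) - c * cexp (-(1 : ℕ) * t) := by
    rw [h1, expSumNumerator, div_eq_iff hd, sub_mul, div_mul_cancel₀ _ hd]
    ring
  rw [h5]
  refine h4.congr_fun fun n ↦ ?_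
  split_ifs with h
  · subst h; push_cast; ring
  · push_cast; ring

/-- The mean value zero kills the constant term of the expansion at t = 0, and the choice of `c`
kills the linear one. -/
lemma isBigO_expSumNumerator (hf : ∑ n ∈ Finset.range N, f n = 0) {c : ℂ}
    (hc : c = -(∑ n ∈ Finset.range N, f n * n) / N) :
    expSumNumerator f c =O[𝓝[>] 0] fun t : ℝ ↦ t ^ 2 := by
  have h1 : (fun t : ℝ ↦ ∑ n ∈ Finset.range N, f n * (cexp (-n * t) - 1 + n * t)) =O[𝓝[>] 0]
      fun t : ℝ ↦ t ^ 2 := IsBigO.fun_sum fun n _ ↦ (isBigO_exp_sub_linear n).const_mul_left _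
  have h2 := ((isBigO_exp_sub_linear 1).const_mul_left c)
  have h3 := ((isBigO_exp_sub_linear (N + 1)).const_mul_left c)
  refine ((h1.sub h2).add h3).congr_left fun t ↦ ?_
  have hN : (N : ℂ) ≠ 0 := by exact_mod_cast NeZero.ne N
  have h4 : ∑ n ∈ Finset.range N, f n * n = -c * N := by rw [hc]; field_simp
  have h5 : ∑ n ∈ Finset.range N, f n * (cexp (-n * t) - 1 + n * t) =
      ∑ n ∈ Finset.range N, f n * cexp (-n * t) - ∑ n ∈ Finset.range N, f n
        + (∑ n ∈ Finset.range N, f n * n) * t := by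
    rw [Finset.sum_mul, ← Finset.sum_sub_distrib, ← Finset.sum_add_distrib]
    exact Finset.sum_congr rfl fun n _ ↦ by ring
  have h6 : cexp (-(N + 1) * t) = cexp (-N * t) * cexp (-1 * t) := by
    rw [← Complex.exp_add]; ring_nf
  rw [h5, hf, h4, h6, expSumNumerator]
  push_cast
  ring

lemma isBigO_inv_one_sub_exp (N : ℕ) [NeZero N] :
    (fun t : ℝ ↦ (1 - cexp (-N * t))⁻¹) =O[𝓝[>] 0] fun t : ℝ ↦ t⁻¹ := by
  have hN : (0 : ℝ) < N := by exact_mod_cast NeZero.pos N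
  refine IsBigO.of_bound (2 / N) ?_
  filter_upwards [Ioo_mem_nhdsGT (show (0 : ℝ) < 1 / N by positivity)] with t ht
  obtain ⟨h0, h1⟩ := ht
  have e : (1 - cexp (-N * t)) = ((1 - Real.exp (-(N * t)) : ℝ) : ℂ) := by
    push_cast; ring_nf
  rw [e, norm_inv, norm_inv, Complex.norm_real, Real.norm_eq_abs, Real.norm_eq_abs, abs_of_pos h0]
  have hx : 0 < N * t := by positivity
  have hx1 : N * t < 1 := by rwa [lt_div_iff₀' hN] at h1
  have h2 : N * t / 2 ≤ 1 - Real.exp (-(N * t)) := by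
    rw [Real.exp_neg]
    have h3 := Real.add_one_le_exp (N * t)
    have h4 : (Real.exp (N * t))⁻¹ ≤ (N * t + 1)⁻¹ := inv_anti₀ (by positivity) h3
    have h5 : (N * t + 1)⁻¹ ≤ 1 - N * t / 2 := by
      rw [inv_le_iff_one_le_mul₀ (by positivity)]
      nlinarith
    linarith
  rw [abs_of_pos (by linarith [h2, hx])]
  calc (1 - Real.exp (-(N * t)))⁻¹ ≤ (N * t / 2)⁻¹ := inv_anti₀ (by positivity) h2
    _ = 2 / N * t⁻¹ := by field_simp

lemma isBigO_expSum_atTop (hf : f 0 = 0) (c : ℂ) :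
    (fun t : ℝ ↦ expSumNumerator f c t / (1 - cexp (-N * t))) =O[atTop]
      fun t : ℝ ↦ Real.exp (-1 * t) := by
  have e (k : ℂ) (t : ℝ) : ‖cexp (-k * t)‖ = Real.exp (-(k.re * t)) := by
    rw [Complex.norm_exp]; simp
  have h1 (n : ℕ) (hn : 1 ≤ n) : (fun t : ℝ ↦ cexp (-n * t)) =O[atTop]
      fun t : ℝ ↦ Real.exp (-1 * t) := by
    refine IsBigO.of_bound 1 ?_
    filter_upwards [eventually_ge_atTop 0] with t ht
    rw [e, Real.norm_eq_abs, Real.abs_exp, one_mul, Real.exp_le_exp, natCast_re]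
    have : (1 : ℝ) ≤ n := by exact_mod_cast hn
    nlinarith
  have h2 : Tendsto (fun t : ℝ ↦ cexp (-N * t)) atTop (𝓝 0) := by
    refine (h1 N (NeZero.pos N)).trans_tendsto ?_
    simpa using Real.tendsto_exp_neg_atTop_nhds_zero
  have h3 : (fun t : ℝ ↦ 1 - cexp (-N * t)) =O[atTop] fun _ ↦ (1 : ℝ) :=
    (tendsto_const_nhds.sub h2).isBigO_one ℝ
  have h4 : (fun t : ℝ ↦ (1 - cexp (-N * t))⁻¹) =O[atTop] fun _ ↦ (1 : ℝ) :=
    ((tendsto_const_nhds.sub h2).inv₀ (by simp)).isBigO_one ℝ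
  have h5 : expSumNumerator f c =O[atTop] fun t : ℝ ↦ Real.exp (-1 * t) := by
    refine IsBigO.sub (IsBigO.fun_sum fun n _ ↦ ?_) ?_
    · rcases Nat.eq_zero_or_pos n with rfl | hn
      · simpa [hf] using isBigO_zero _ _
      · exact (h1 n hn).const_mul_left _
    · simpa using (h3.const_mul_left c).mul (h1 1 le_rfl)
  simpa [div_eq_mul_inv] using h5.mul h4

/-- The value at `0` of the `L`-function of a function on `ℤ/N` of mean value zero. -/
theorem ZMod.LFunction_apply_zero_of_sum_eq_zero (hf0 : f 0 = 0) (hf : ∑ j, f j = 0) :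
    ZMod.LFunction f 0 = -(∑ n ∈ Finset.range N, f n * n) / N := by
  set c : ℂ := -(∑ n ∈ Finset.range N, f n * n) / N with hc
  have hf' : ∑ n ∈ Finset.range N, f n = 0 := by
    rw [← ZMod.sum_eq_sum_range, hf]
  -- Subtracting c at n = 1 changes the Dirichlet series by the constant c and makes the generating
  -- function O(t) at 0. Its Mellin transform is then holomorphic for Re s > -1, a region containing
  -- 0.
  set G : ℝ → ℂ := fun t ↦ expSumNumerator f c t / (1 - cexp (-N * t)) with hG
  have hGdiff (s : ℂ) (hs : -1 < s.re) : DifferentiableAt ℂ (mellin G) s := by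
    refine mellin_differentiableAt_of_isBigO_rpow_exp one_pos ?_ (isBigO_expSum_atTop hf0 c)
      (b := -1) ?_ hs
    · refine ContinuousOn.locallyIntegrableOn ?_ measurableSet_Ioi
      refine ContinuousOn.div (by unfold expSumNumerator; fun_prop) (by fun_prop) fun t ht ↦ ?_
      exact one_sub_cexp_neg_mul_ne_zero N ht
    · have h := (isBigO_expSumNumerator hf' hc).mul (isBigO_inv_one_sub_exp N)
      refine (h.congr_left fun t ↦ by simp only [hG, div_eq_mul_inv]).trans_eventuallyEq ?_
      filter_upwards [self_mem_nhdsWithin] with t ht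
      have : t ≠ 0 := ne_of_gt ht
      simp
      field_simp
  have hmellin {s : ℂ} (hs : 1 < s.re) : ZMod.LFunction f s - c = mellin G s * (Gamma s)⁻¹ := by
    have h1 := hasSum_mellin (a := fun n : ℕ ↦ f n - if n = 1 then c else 0) (p := fun n ↦ n) (F := G)
      (s := s) (fun n ↦ ?_) (by linarith) (fun t ht ↦ hasSum_expSum f c ht) ?_
    · have h2 : HasSum (LSeries.term (fun n ↦ f n) s) (ZMod.LFunction f s) := by
        rw [ZMod.LFunction_eq_LSeries f hs]
        exact (ZMod.LSeriesSummable_of_one_lt_re f hs).LSeriesHasSum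
      have h3 := (h2.sub (hasSum_ite_eq (1 : ℕ) c)).mul_left (Gamma s)
      rw [eq_mul_inv_iff_mul_eq₀ (Gamma_ne_zero_of_re_pos (by linarith)), mul_comm]
      refine h3.unique (h1.congr_fun fun n ↦ ?_)
      rcases eq_or_ne n 0 with rfl | hn
      · simp [hf0]
      · rw [LSeries.term_of_ne_zero hn]
        rcases eq_or_ne n 1 with rfl | hn1
        · simp
        · simp [hn1, mul_div_assoc]
    · rcases Nat.eq_zero_or_pos n with rfl | hn
      · left; simp [hf0]
      · right; exact_mod_cast hn
    · obtain ⟨M, hM⟩ := ZMod.exists_norm_le f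
      refine Summable.of_nonneg_of_le (fun n ↦ by positivity) (fun n ↦ ?_)
        ((Real.summable_one_div_nat_rpow.mpr hs).mul_left (M + ‖c‖))
      rw [mul_one_div]
      gcongr
      refine (norm_sub_le _ _).trans (add_le_add (hM _) ?_)
      split_ifs <;> simp
  have hEq : Set.EqOn (fun s ↦ ZMod.LFunction f s - c) (fun s ↦ mellin G s * (Gamma s)⁻¹)
      {s : ℂ | -1 < s.re} := by
    have hopen : IsOpen {s : ℂ | -1 < s.re} := isOpen_lt continuous_const continuous_re
    have hL := ZMod.differentiable_LFunction_of_sum_zero hf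
    refine AnalyticOnNhd.eqOn_of_preconnected_of_eventuallyEq (z₀ := 2)
      (DifferentiableOn.analyticOnNhd (hL.sub_const c).differentiableOn hopen)
      (DifferentiableOn.analyticOnNhd (fun s hs ↦ ?_) hopen)
      (convex_halfSpace_re_gt (-1)).isPreconnected (by simp; norm_num) ?_
    · exact ((hGdiff s hs).mul (differentiable_one_div_Gamma s)).differentiableWithinAt
    · have : {s : ℂ | 1 < s.re} ∈ 𝓝 (2 : ℂ) :=
        (isOpen_lt continuous_const continuous_re).mem_nhds (by simp)
      filter_upwards [this] with s hs using hmellin hs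
  have h0 : ZMod.LFunction f 0 - c = mellin G 0 * (Gamma 0)⁻¹ :=
    hEq (show (0 : ℂ) ∈ {s : ℂ | -1 < s.re} by simp)
  -- The convention `Gamma 0 = 0` with `0⁻¹ = 0` agrees with the zero at s = 0 of the entire
  -- function 1/Γ, so L(0) = c.
  rw [Complex.Gamma_zero, _root_.inv_zero, mul_zero] at h0
  exact sub_eq_zero.mp h0

/-- The value at `0` of the `L`-function of a nontrivial Dirichlet character. -/
theorem DirichletCharacter.LFunction_apply_zero {χ : DirichletCharacter ℂ N} (hχ : χ ≠ 1)
    (hN : N ≠ 1) : χ.LFunction 0 = ∑ b : ZMod N, χ b * (1 / 2 - b.val / N) := by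
  have h0 : χ 0 = 0 := χ.map_zero' hN
  have h1 := χ.sum_eq_zero_of_ne_one hχ
  have h2 := ZMod.LFunction_apply_zero_of_sum_eq_zero h0 h1
  rw [DirichletCharacter.LFunction, h2]
  simp only [mul_sub, Finset.sum_sub_distrib, ← Finset.sum_mul, h1]
  rw [ZMod.sum_eq_sum_range, zero_mul, zero_sub, neg_div, Finset.sum_div]
  congr 1
  refine Finset.sum_congr rfl fun n hn ↦ ?_
  rw [ZMod.val_cast_of_lt (Finset.mem_range.mp hn), mul_div_assoc]

/-- A nontrivial Dirichlet character of prime level is primitive. -/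
lemma DirichletCharacter.isPrimitive_of_ne_one {p : ℕ} [NeZero p] (hp : p.Prime) {χ : DirichletCharacter ℂ p}
    (hχ : χ ≠ 1) : χ.IsPrimitive := by
  rcases (Nat.dvd_prime hp).mp χ.conductor_dvd_level with h | h
  · exact absurd (DirichletCharacter.eq_one_iff_conductor_eq_one.mpr h) hχ
  · exact h

lemma DirichletCharacter.Odd.ne_one {m : ℕ} {χ : DirichletCharacter ℂ m} (hχ : χ.Odd) : χ ≠ 1 := by
  rintro rfl
  have h : (1 : DirichletCharacter ℂ m) (-1) = -1 := hχ
  rw [MulChar.one_apply isUnit_one.neg] at h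
  norm_num at h

lemma DirichletCharacter.Odd.inv {m : ℕ} {χ : DirichletCharacter ℂ m} (hχ : χ.Odd) : (χ⁻¹).Odd := by
  rw [DirichletCharacter.Odd, MulChar.inv_apply_eq_inv', hχ]
  norm_num

/-- The `L`-function of an odd Dirichlet character of prime level does not vanish at `0`. -/
theorem DirichletCharacter.LFunction_apply_zero_ne_zero {p : ℕ} [NeZero p] (hp : p.Prime)
    {χ : DirichletCharacter ℂ p} (hχ : χ.Odd) : χ.LFunction 0 ≠ 0 := by
  intro h0
  have hp1 : p ≠ 1 := hp.ne_one
  have hprim := DirichletCharacter.isPrimitive_of_ne_one hp hχ.inv.ne_one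
  -- The odd gamma factor at 0 is Γ_ℝ(1) ≠ 0. A zero of L(s, χ) at 0 would thus give, by the
  -- functional equation, a zero of L(s, χ⁻¹) at 1.
  have h := hprim.completedLFunction_one_sub 0
  have h1 := χ.LFunction_eq_completed_div_gammaFactor 0 (Or.inr hp1)
  have h2 := (χ⁻¹).LFunction_eq_completed_div_gammaFactor 1 (Or.inr hp1)
  have h3 := DirichletCharacter.LFunction_apply_one_ne_zero hχ.inv.ne_one
  rw [hχ.gammaFactor_def, zero_add] at h1
  have h4 : Gammaℝ 1 ≠ 0 := Gammaℝ_ne_zero_of_re_pos (by simp)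
  rw [h0, eq_comm, div_eq_zero_iff, or_iff_left h4] at h1
  rw [inv_inv, h1, mul_zero, sub_zero] at h
  rw [h, zero_div] at h2
  exact h3 h2

end LValue

/-! ### Eisenstein series attached to residue classes. -/

section LevelEisenstein

open Complex
open UpperHalfPlane hiding I

variable {N : ℕ} [NeZero N]

/-- The weight one Eisenstein series of level `N` attached to a residue class. -/
noncomputable def levelEisenstein {N : ℕ} (b : ZMod N) (τ : ℍ) : ℂ :=
  torsionEisenstein (b.val / N) 0 (N * τ)

lemma isNonintegral_val_div {b : ZMod N} (hb : b ≠ 0) (s : ℝ) : IsNonintegral (b.val / N) s := by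
  intro m _ hm
  exfalso
  have hN : (0 : ℝ) < N := by exact_mod_cast NeZero.pos N
  rw [div_eq_iff hN.ne'] at hm
  have h1 : (b.val : ℤ) = m * N := by exact_mod_cast hm
  have h2 : (b.val : ℤ) < N := by exact_mod_cast b.val_lt
  have h3 : 0 < (b.val : ℤ) := by
    have : b.val ≠ 0 := by rwa [ne_eq, ZMod.val_eq_zero]
    omega
  have hN' : (0 : ℤ) < N := by exact_mod_cast NeZero.pos N
  rcases lt_trichotomy m 0 with h | h | h <;> nlinarith

lemma torsionEisenstein_add_intCast_right (r s : ℝ) (n : ℤ) (τ : ℂ) :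
    torsionEisenstein r (s + n) τ = torsionEisenstein r s τ := by
  have h : Function.Periodic (fun s ↦ torsionEisenstein r s τ) 1 :=
    fun s ↦ torsionEisenstein_add_one_right r s τ
  simpa using (h.int_mul n) s

lemma torsionEisenstein_add_intCast_left {r s : ℝ} (h : IsNonintegral r s) (m : ℤ) {τ : ℂ}
    (hτ : 0 < τ.im) : torsionEisenstein (r + m) s τ = torsionEisenstein r s τ := by
  have hk (k : ℤ) : IsNonintegral (r + k) s := fun m n hm hn ↦
    h (m - k) n (by push_cast; linarith) hn
  have step (k : ℤ) : torsionEisenstein (r + (k + 1 : ℤ)) s τ = torsionEisenstein (r + k) s τ := by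
    rw [← torsionEisenstein_add_one_left (hk k) hτ]
    congr 1
    push_cast
    ring
  induction m using Int.induction_on with
  | zero => simp
  | succ n ih => rw [step, ih]
  | pred n ih => rw [← step, sub_add_cancel, ih]

/-- Multiplication by `N` on the upper half plane. -/
noncomputable def natMulUpperHalfPlane (N : ℕ) [NeZero N] (τ : ℍ) : ℍ :=
  ⟨N * τ, by
    have : (0 : ℝ) < N := by exact_mod_cast NeZero.pos N
    have := τ.im_pos
    simp only [mul_im, natCast_re, natCast_im, zero_mul, add_zero]
    positivity⟩

/-- The action of `Γ₀(N)` on the weight one Eisenstein series of level `N`. -/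
theorem levelEisenstein_smul (γ : CongruenceSubgroup.Gamma0 N) {b : ZMod N} (hb : b ≠ 0) (τ : ℍ) :
    levelEisenstein b ((γ : SL(2, ℤ)) • τ) =
      ((((γ : SL(2, ℤ)) 1 0 : ℤ) : ℂ) * (τ : ℂ) + (((γ : SL(2, ℤ)) 1 1 : ℤ) : ℂ)) *
        levelEisenstein (b * (((γ : SL(2, ℤ)) 0 0 : ℤ) : ZMod N)) τ := by
  obtain ⟨γ, hγ⟩ := γ
  obtain ⟨c, hc⟩ := (ZMod.intCast_zmod_eq_zero_iff_dvd _ _).mp (CongruenceSubgroup.Gamma0_mem.mp hγ)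
  have hdet : γ 0 0 * γ 1 1 - γ 0 1 * γ 1 0 = 1 := by
    have := γ.det_coe
    rwa [Matrix.det_fin_two] at this
  -- This is the conjugate of γ by diag(N, 1), integral because N divides the lower left entry; it
  -- acts on Nτ as γ acts on τ.
  obtain ⟨g, hg⟩ : ∃ g : SL(2, ℤ), (g : Matrix (Fin 2) (Fin 2) ℤ) = !![γ 0 0, N * γ 0 1; c, γ 1 1] :=
    ⟨⟨!![γ 0 0, N * γ 0 1; c, γ 1 1], by
      rw [Matrix.det_fin_two_of]
      rw [hc] at hdet
      linear_combination hdet⟩, rfl⟩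
  have g00 : g 0 0 = γ 0 0 := by rw [hg]; rfl
  have g01 : g 0 1 = N * γ 0 1 := by rw [hg]; rfl
  have g10 : g 1 0 = c := by rw [hg]; rfl
  have g11 : g 1 1 = γ 1 1 := by rw [hg]; rfl
  have hN : (N : ℂ) ≠ 0 := by exact_mod_cast NeZero.ne N
  have hNR : (N : ℝ) ≠ 0 := by exact_mod_cast NeZero.ne N
  have hcoe : ((g • natMulUpperHalfPlane N τ : ℍ) : ℂ) = N * (γ • τ : ℍ) := by
    rw [coe_specialLinearGroup_apply, coe_specialLinearGroup_apply, g00, g01, g10, g11, hc]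
    simp only [natMulUpperHalfPlane, algebraMap_int_eq, eq_intCast, coe_mk]
    push_cast
    rw [mul_div_assoc', mul_add]
    congr 1 <;> ring
  have h := torsionEisenstein_smul g (isNonintegral_val_div hb 0) (natMulUpperHalfPlane N τ)
  rw [hcoe, ModularGroup.denom_apply, g00, g01, g10, g11] at h
  simp only [levelEisenstein]
  rw [h]
  have e1 : (c : ℂ) * (natMulUpperHalfPlane N τ : ℂ) + (γ 1 1 : ℤ) =
      ((γ 1 0 : ℤ) : ℂ) * τ + (γ 1 1 : ℤ) := by
    rw [hc]
    simp only [natMulUpperHalfPlane, coe_mk]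
    push_cast
    ring
  rw [e1]
  congr 1
  simp only [zero_mul, add_zero]
  -- The row vector (b/N, 0) times g has an integral second entry, which drops out by periodicity.
  -- The first is congruent modulo 1 to the representative of b times the upper left entry.
  have e2 : (b.val / N * ((N * γ 0 1 : ℤ) : ℝ) : ℝ) = 0 + (b.val * γ 0 1 : ℤ) := by
    push_cast
    field_simp
    ring
  rw [e2, torsionEisenstein_add_intCast_right]
  obtain ⟨k, hk⟩ : ∃ k : ℤ, (b.val : ℤ) * γ 0 0 = (b * ((γ 0 0 : ℤ) : ZMod N)).val + N * k := by
    have : (((b.val : ℤ) * γ 0 0 - (b * ((γ 0 0 : ℤ) : ZMod N)).val : ℤ) : ZMod N) = 0 := by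
      push_cast
      rw [ZMod.natCast_zmod_val, ZMod.natCast_zmod_val, sub_self]
    obtain ⟨k, hk⟩ := (ZMod.intCast_zmod_eq_zero_iff_dvd _ _).mp this
    exact ⟨k, by linarith⟩
  have hk' : (b.val : ℝ) * γ 0 0 = (b * ((γ 0 0 : ℤ) : ZMod N)).val + N * k := by exact_mod_cast hk
  have hb' : b * ((γ 0 0 : ℤ) : ZMod N) ≠ 0 := by
    intro h0
    apply hb
    have h1 : ((γ 0 0 : ℤ) : ZMod N) * (γ 1 1 : ℤ) = 1 := by
      have h2 : ((γ 0 0 * γ 1 1 - γ 0 1 * γ 1 0 : ℤ) : ZMod N) = 1 := by rw [hdet]; simp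
      push_cast at h2
      rwa [CongruenceSubgroup.Gamma0_mem.mp hγ, mul_zero, sub_zero] at h2
    rw [← mul_one b, ← h1, ← mul_assoc, h0, zero_mul]
  have e3 : (b.val / N * (γ 0 0 : ℤ) : ℝ) = (b * ((γ 0 0 : ℤ) : ZMod N)).val / N + k := by
    field_simp
    linarith
  rw [e3]
  exact torsionEisenstein_add_intCast_left (isNonintegral_val_div hb' 0) k
    (natMulUpperHalfPlane N τ).im_pos

lemma nome_ne_zero (τ : ℍ) : nome τ ≠ 0 := Complex.exp_ne_zero _

lemma norm_nome_lt_one (τ : ℍ) : ‖nome τ‖ < 1 := norm_cexp_two_pi_I_mul_lt_one τ.im_pos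

lemma val_pos_of_ne_zero {m : ℕ} {b : ZMod m} (hb : b ≠ 0) : 0 < b.val :=
  Nat.pos_of_ne_zero (by rwa [ne_eq, ZMod.val_eq_zero])

lemma norm_pow_lt_one {q : ℂ} (hq : ‖q‖ < 1) {n : ℕ} (hn : 0 < n) : ‖q ^ n‖ < 1 := by
  rw [norm_pow]
  exact pow_lt_one₀ (norm_nonneg _) hq hn.ne'

lemma norm_pow_lt_norm_pow {q : ℂ} (hq0 : q ≠ 0) (hq : ‖q‖ < 1) {m n : ℕ} (h : m < n) :
    ‖q ^ n‖ < ‖q ^ m‖ := by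
  rw [norm_pow, norm_pow]
  exact pow_lt_pow_right_of_lt_one₀ (norm_pos_iff.mpr hq0) hq h

/-- The `q`-expansion of the weight one Eisenstein series of level `N`. -/
theorem levelEisenstein_eq_kroneckerSeries {b : ZMod N} (hb : b ≠ 0) (τ : ℍ) :
    levelEisenstein b τ = kroneckerSeries (nome τ ^ N) (nome τ ^ b.val) - b.val / N := by
  have hN : (N : ℂ) ≠ 0 := by exact_mod_cast NeZero.ne N
  have hu : (((b.val / N : ℝ) : ℂ) * (N * τ) + ((0 : ℝ) : ℂ)) = b.val * τ := by
    push_cast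
    field_simp
    ring
  have h1 : 0 < ((b.val : ℂ) * τ).im := by
    have h1 : (0 : ℝ) < b.val := by exact_mod_cast val_pos_of_ne_zero hb
    have h2 := τ.im_pos
    simp only [mul_im, natCast_re, natCast_im, zero_mul, add_zero]
    positivity
  have h2 : ((b.val : ℂ) * τ).im < ((N : ℂ) * τ).im := by
    have h1 : (b.val : ℝ) < N := by exact_mod_cast b.val_lt
    have h2 := τ.im_pos
    simp only [mul_im, natCast_re, natCast_im, zero_mul, add_zero]
    gcongr
  have e (n : ℕ) : cexp (2 * Real.pi * I * (n * τ)) = nome τ ^ n := by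
    rw [nome, ← Complex.exp_nat_mul]
    ring_nf
  have h3 := jacobiTheta₂'_eq_kroneckerSeries_mul h1 h2
  have h4 := jacobiTheta₂_ne_zero_of_im h1 h2
  have hpi : (Real.pi : ℂ) ≠ 0 := by exact_mod_cast Real.pi_ne_zero
  rw [levelEisenstein, torsionEisenstein, hu, h3, e, e]
  generalize jacobiTheta₂ (b.val * τ - 1 / 2 - N * τ / 2) (N * τ) = A at *
  push_cast
  field_simp
  ring

end LevelEisenstein

/-! ### Hecke's Eisenstein series as a character sum over residue classes. -/

section HeckeEisenstein

open Complex
open UpperHalfPlane hiding I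

variable {N : ℕ} [NeZero N]

/-- The Kronecker series as a Lambert series. -/
lemma kroneckerSeries_eq_tsum_pnat {Q x : ℂ} (hQ0 : Q ≠ 0) (hx1 : ‖x‖ < 1) (hQx : ‖Q‖ < ‖x‖) :
    HasSum (fun n : ℕ+ ↦ (x ^ (n : ℕ) - (Q / x) ^ (n : ℕ)) / (1 - Q ^ (n : ℕ)))
      (kroneckerSeries Q x - 1 / 2) := by
  have hs := (hasSum_kroneckerSeries hQ0 hx1 hQx).summable
  obtain ⟨h1, h2⟩ := summable_int_iff_summable_nat_and_neg.mp hs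
  have h3 := (summable_pnat_iff_summable_nat.mpr h1)
  have h4 := (summable_pnat_iff_summable_nat.mpr h2)
  have h5 := tsum_int_eq_zero_add_tsum_pnat hs
  have h6 : kroneckerSeries Q x - 1 / 2 =
      ∑' n : ℕ+, kroneckerCoeff Q (n : ℕ) * x ^ ((n : ℕ) : ℤ) +
        ∑' n : ℕ+, kroneckerCoeff Q (-(n : ℕ)) * x ^ (-((n : ℕ) : ℤ)) := by
    rw [kroneckerSeries, h5]
    simp [kroneckerCoeff]
    ring
  rw [h6]
  refine (h3.hasSum.add h4.hasSum).congr_fun fun n ↦ ?_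
  have hn : ((n : ℕ) : ℤ) ≠ 0 := by exact_mod_cast n.ne_zero
  rw [kroneckerCoeff_neg (hQx.trans hx1) hQ0 hn]
  simp only [kroneckerCoeff, hn, if_false, zpow_natCast, zpow_neg, div_pow]
  ring

/-- Shifting the index by a full period multiplies the power series by y^N; f 0 = 0 allows the sum
to start at 1. -/
lemma tsum_pnat_apply_mul_pow (f : ZMod N → ℂ) (hf : f 0 = 0) {y : ℂ} (hy : ‖y‖ < 1) :
    ∑' n : ℕ+, f (n : ℕ) * y ^ (n : ℕ) = (∑ b, f b * y ^ b.val) / (1 - y ^ N) := by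
  obtain ⟨M, hM⟩ := ZMod.exists_norm_le f
  have hs : Summable fun n : ℕ ↦ f n * y ^ n := by
    refine Summable.of_norm_bounded
      ((summable_geometric_of_lt_one (norm_nonneg y) hy).mul_left M) fun n ↦ ?_
    rw [norm_mul, norm_pow]
    gcongr
    exact hM _
  have hd : 1 - y ^ N ≠ 0 := by
    intro h
    have := norm_pow_lt_one hy (NeZero.pos N)
    rw [← sub_eq_zero.mp h, norm_one] at this
    exact lt_irrefl _ this
  have h2 := hs.sum_add_tsum_nat_add N
  have h3 (n : ℕ) : f (n + N : ℕ) * y ^ (n + N) = f n * y ^ n * y ^ N := by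
    rw [pow_add]
    simp
    ring
  rw [tsum_congr h3, tsum_mul_right] at h2
  have h4 : ∑ b, f b * y ^ b.val = ∑ n ∈ Finset.range N, f n * y ^ n := by
    rw [ZMod.sum_eq_sum_range]
    exact Finset.sum_congr rfl fun n hn ↦ by
      rw [ZMod.val_cast_of_lt (Finset.mem_range.mp hn)]
  have h5 : ∑' n : ℕ+, f (n : ℕ) * y ^ (n : ℕ) = ∑' n : ℕ, f n * y ^ n := by
    rw [tsum_pnat_eq_tsum_succ (f := fun n : ℕ ↦ f n * y ^ n), hs.tsum_eq_zero_add]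
    simp [hf]
  rw [h5, h4, eq_div_iff hd]
  linear_combination -h2

lemma tsum_pnat_pow {y : ℂ} (hy : ‖y‖ < 1) : ∑' n : ℕ+, y ^ (n : ℕ) = y / (1 - y) := by
  rw [tsum_pnat_eq_tsum_succ (f := fun n : ℕ ↦ y ^ n)]
  simp only [pow_succ, tsum_mul_right, tsum_geometric_of_norm_lt_one hy]
  rw [div_eq_inv_mul]

/-- Exchange of summation in a Lambert series with periodic coefficients. -/
lemma tsum_lambert (f : ZMod N → ℂ) (hf : f 0 = 0) {q : ℂ} (hq : ‖q‖ < 1) :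
    ∑' n : ℕ+, f (n : ℕ) * (q ^ (n : ℕ) / (1 - q ^ (n : ℕ))) =
      ∑' m : ℕ+, (∑ b, f b * (q ^ (m : ℕ)) ^ b.val) / (1 - (q ^ (m : ℕ)) ^ N) := by
  obtain ⟨M, hM⟩ := ZMod.exists_norm_le f
  have hs : Summable fun c : ℕ+ × ℕ+ ↦ f (c.1 : ℕ) * q ^ (c.1 * c.2 : ℕ) := by
    have h := (summable_prod_mul_pow 0 hq).norm.mul_left M
    refine Summable.of_norm_bounded h fun c ↦ ?_
    rw [norm_mul, pow_zero, one_mul]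
    gcongr
    exact hM _
  have h1 (n : ℕ+) : f (n : ℕ) * (q ^ (n : ℕ) / (1 - q ^ (n : ℕ))) =
      ∑' m : ℕ+, f (n : ℕ) * q ^ (n * m : ℕ) := by
    rw [tsum_mul_left, ← tsum_pnat_pow (norm_pow_lt_one hq n.pos)]
    simp only [pow_mul]
  have h2 (m : ℕ+) : (∑ b, f b * (q ^ (m : ℕ)) ^ b.val) / (1 - (q ^ (m : ℕ)) ^ N) =
      ∑' n : ℕ+, f (n : ℕ) * q ^ (n * m : ℕ) := by
    rw [← tsum_pnat_apply_mul_pow f hf (norm_pow_lt_one hq m.pos)]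
    refine tsum_congr fun n ↦ ?_
    rw [← pow_mul, mul_comm (m : ℕ)]
  rw [tsum_congr h1, tsum_congr h2]
  exact (Summable.tsum_comm (f := fun n m : ℕ+ ↦ f (n : ℕ) * q ^ (n * m : ℕ)) hs).symm

/-- The Hecke Eisenstein series of weight one as a combination of the Eisenstein series attached
to residue classes. -/
theorem LFunction_zero_mul_heckeEisenstein {χ : DirichletCharacter ℂ N} (hχ : χ.Odd) (hN : N ≠ 1)
    (hL : χ.LFunction 0 ≠ 0) (τ : ℍ) :
    χ.LFunction 0 * heckeEisenstein 1 χ τ = ∑ b : ZMod N, χ b * levelEisenstein b τ := by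
  have h0 : χ 0 = 0 := χ.map_zero' hN
  set q := nome τ with hq
  have hq0 : q ≠ 0 := nome_ne_zero τ
  have hq1 : ‖q‖ < 1 := norm_nome_lt_one τ
  have hE : χ.LFunction 0 * heckeEisenstein 1 χ τ = χ.LFunction 0 +
      2 * ∑' m : ℕ+, (∑ b, χ b * (q ^ (m : ℕ)) ^ b.val) / (1 - (q ^ (m : ℕ)) ^ N) := by
    rw [← tsum_lambert (fun b ↦ χ b) h0 hq1, heckeEisenstein]
    have h1 (n : ℕ+) : χ (n : ℕ) * (((n : ℕ) : ℂ) ^ (1 - 1) * q ^ (n : ℕ) / (1 - q ^ (n : ℕ))) =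
        χ (n : ℕ) * (q ^ (n : ℕ) / (1 - q ^ (n : ℕ))) := by simp
    rw [tsum_congr h1, Nat.cast_one, sub_self, mul_add, mul_one, ← mul_assoc, mul_div_cancel₀ _ hL]
  -- The series is compared after removal of its constant term 1/2 - b/N; these constants, weighted
  -- by χ, add up to L(0, χ). The class b = 0, a lattice point, is discarded by χ(0) = 0.
  have hterm (b : ZMod N) : HasSum (fun m : ℕ+ ↦ χ b *
      (((q ^ (m : ℕ)) ^ b.val - (q ^ (m : ℕ)) ^ (N - b.val)) / (1 - (q ^ (m : ℕ)) ^ N)))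
      (χ b * (levelEisenstein b τ - (1 / 2 - b.val / N))) := by
    rcases eq_or_ne b 0 with rfl | hb
    · simp [h0, hasSum_zero]
    · rw [levelEisenstein_eq_kroneckerSeries hb]
      have h := kroneckerSeries_eq_tsum_pnat (pow_ne_zero N hq0)
        (norm_pow_lt_one hq1 (val_pos_of_ne_zero hb)) (norm_pow_lt_norm_pow hq0 hq1 b.val_lt)
      rw [div_eq_mul_inv, ← pow_sub₀ _ hq0 b.val_lt.le] at h
      have hv : χ b * (kroneckerSeries (nome τ ^ N) (nome τ ^ b.val) - b.val / N -
          (1 / 2 - b.val / N)) = χ b * (kroneckerSeries (q ^ N) (q ^ b.val) - 1 / 2) := by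
        rw [← hq]
        ring
      rw [hv]
      refine (h.mul_left (χ b)).congr_fun fun m ↦ ?_
      simp only [← pow_mul, mul_comm (m : ℕ)]
  have hsum := hasSum_sum (s := Finset.univ) fun b _ ↦ hterm b
  have hinner (m : ℕ+) : ∑ b : ZMod N, χ b *
      (((q ^ (m : ℕ)) ^ b.val - (q ^ (m : ℕ)) ^ (N - b.val)) / (1 - (q ^ (m : ℕ)) ^ N)) =
      2 * ((∑ b, χ b * (q ^ (m : ℕ)) ^ b.val) / (1 - (q ^ (m : ℕ)) ^ N)) := by
    -- Replacing b by -b exchanges the two powers, and oddness of χ makes both halves equal. This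
    -- accounts for the factor 2.
    have h1 : ∑ b : ZMod N, χ b * (q ^ (m : ℕ)) ^ (N - b.val) =
        -∑ b : ZMod N, χ b * (q ^ (m : ℕ)) ^ b.val := by
      rw [← Equiv.sum_comp (Equiv.neg (ZMod N)), ← Finset.sum_neg_distrib]
      refine Finset.sum_congr rfl fun b _ ↦ ?_
      rcases eq_or_ne b 0 with rfl | hb
      · simp [h0]
      · rw [Equiv.neg_apply, hχ.eval_neg, ZMod.neg_val, if_neg hb,
          Nat.sub_sub_self b.val_lt.le, neg_mul]
    have h2 : ∑ b : ZMod N, χ b *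
        (((q ^ (m : ℕ)) ^ b.val - (q ^ (m : ℕ)) ^ (N - b.val)) / (1 - (q ^ (m : ℕ)) ^ N)) =
        (∑ b : ZMod N, χ b * (q ^ (m : ℕ)) ^ b.val
          - ∑ b : ZMod N, χ b * (q ^ (m : ℕ)) ^ (N - b.val)) / (1 - (q ^ (m : ℕ)) ^ N) := by
      rw [← Finset.sum_sub_distrib, Finset.sum_div]
      exact Finset.sum_congr rfl fun b _ ↦ by ring
    rw [h2, h1]
    ring
  simp only [hinner] at hsum
  have h3 := hsum.tsum_eq
  rw [tsum_mul_left] at h3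
  rw [hE, h3, DirichletCharacter.LFunction_apply_zero hχ.ne_one hN, ← Finset.sum_add_distrib]
  exact Finset.sum_congr rfl fun b _ ↦ by ring

end HeckeEisenstein

/-! ### Diamond translates and Fourier inversion over the odd characters. -/

section OddEisenstein

open Complex DirichletCharacter
open UpperHalfPlane hiding I

lemma Gamma0_apply_mul_apply_eq_one {N : ℕ} (γ : CongruenceSubgroup.Gamma0 N) :
    (((γ : SL(2, ℤ)) 0 0 : ℤ) : ZMod N) * (((γ : SL(2, ℤ)) 1 1 : ℤ) : ZMod N) = 1 := by
  obtain ⟨γ, hγ⟩ := γ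
  have h := γ.det_coe
  rw [Matrix.det_fin_two] at h
  have h2 : ((γ 0 0 * γ 1 1 - γ 0 1 * γ 1 0 : ℤ) : ZMod N) = 1 := by rw [h]; simp
  push_cast at h2
  rwa [CongruenceSubgroup.Gamma0_mem.mp hγ, mul_zero, sub_zero] at h2

variable {p : ℕ} [NeZero p]

/-- The modular transformation of the weight one Hecke Eisenstein series. -/
theorem heckeEisenstein_smul (hp : p.Prime) {χ : DirichletCharacter ℂ p} (hχ : χ.Odd)
    (γ : CongruenceSubgroup.Gamma0 p) (τ : ℍ) :
    heckeEisenstein 1 χ ((γ : SL(2, ℤ)) • τ) =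
      ((((γ : SL(2, ℤ)) 1 0 : ℤ) : ℂ) * (τ : ℂ) + (((γ : SL(2, ℤ)) 1 1 : ℤ) : ℂ)) *
        (χ (((γ : SL(2, ℤ)) 1 1 : ℤ) : ZMod p) * heckeEisenstein 1 χ τ) := by
  have hL := LFunction_apply_zero_ne_zero hp hχ
  have hN := hp.ne_one
  have h1 := Gamma0_apply_mul_apply_eq_one γ
  have h0 : χ 0 = 0 := χ.map_zero' hN
  apply mul_left_cancel₀ hL
  set j := (((γ : SL(2, ℤ)) 1 0 : ℤ) : ℂ) * (τ : ℂ) + (((γ : SL(2, ℤ)) 1 1 : ℤ) : ℂ)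
  set d := (((γ : SL(2, ℤ)) 1 1 : ℤ) : ZMod p)
  have hterm (b : ZMod p) : χ b * levelEisenstein b ((γ : SL(2, ℤ)) • τ) =
      χ b * (j * levelEisenstein (b * (((γ : SL(2, ℤ)) 0 0 : ℤ) : ZMod p)) τ) := by
    rcases eq_or_ne b 0 with rfl | hb
    · simp [h0]
    · rw [levelEisenstein_smul γ hb]
  -- The substitution b ↦ b d, with d inverse to the upper left entry, undoes the permutation of
  -- classes and releases the factor χ(d).
  rw [LFunction_zero_mul_heckeEisenstein hχ hN hL, Finset.sum_congr rfl fun b _ ↦ hterm b,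
    ← Equiv.sum_comp (Units.mulRight (⟨d, _, (mul_comm _ _).trans h1, h1⟩ : (ZMod p)ˣ))]
  calc _ = ∑ b : ZMod p, j * χ d * (χ b * levelEisenstein b τ) := by
        refine Finset.sum_congr rfl fun b _ ↦ ?_
        have hb (u : (ZMod p)ˣ) : b * u * (u⁻¹ : (ZMod p)ˣ) = b := Units.mul_inv_cancel_right b u
        rw [Units.mulRight_apply, map_mul]
        exact (congrArg (fun x ↦ χ b * χ d * (j * levelEisenstein x τ)) (hb _)).trans (by ring)
    _ = _ := by
        rw [← Finset.mul_sum, ← LFunction_zero_mul_heckeEisenstein hχ hN hL]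
        ring

open scoped Classical in
/-- The combination of odd weight one Hecke Eisenstein series representing the diamond translate
of `eisensteinSum p` by a residue class. -/
noncomputable def oddEisenstein (τ : ℍ) (a : ZMod p) : ℂ :=
  2 / ((p : ℂ) - 1) * ∑ χ : DirichletCharacter ℂ p with χ.Odd, χ a * heckeEisenstein 1 χ τ

lemma oddEisenstein_neg (τ : ℍ) (a : ZMod p) : oddEisenstein τ (-a) = -oddEisenstein τ a := by
  rw [oddEisenstein, oddEisenstein, ← mul_neg, ← Finset.sum_neg_distrib]
  congr 1
  refine Finset.sum_congr rfl fun χ hχ ↦ ?_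
  simp only [Finset.mem_filter, Finset.mem_univ, true_and] at hχ
  rw [hχ.eval_neg, neg_mul]

/-- Independence of the representatives: the automorphy factors cancel and only χ(a) survives in
each summand. At prime level, odd characters are automatically primitive. -/
theorem eisensteinGen_eq_oddEisenstein (hp : p.Prime) {γ : ℕ → CongruenceSubgroup.Gamma0 p}
    (hγ : IsDiamondSystem p γ) {a : ℕ} (ha : a.Coprime p) (τ : ℍ) :
    eisensteinGen γ a τ = oddEisenstein τ (a : ZMod p) := by
  classical
  have hj : (((γ a : SL(2, ℤ)) 1 0 : ℤ) : ℂ) * (τ : ℂ) + (((γ a : SL(2, ℤ)) 1 1 : ℤ) : ℂ) ≠ 0 := by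
    have := denom_ne_zero (γ a : SL(2, ℤ)) τ
    rwa [ModularGroup.denom_apply] at this
  rw [eisensteinGen, diamond, eisensteinSum, oddEisenstein, zpow_neg_one, mul_left_comm]
  congr 1
  rw [Finset.mul_sum]
  refine Finset.sum_congr (Finset.filter_congr fun χ _ ↦
    ⟨And.left, fun h ↦ ⟨h, isPrimitive_of_ne_one hp h.ne_one⟩⟩) fun χ hχ ↦ ?_
  simp only [Finset.mem_filter, Finset.mem_univ, true_and] at hχ
  rw [heckeEisenstein_smul hp hχ, inv_mul_cancel_left₀ hj, hγ a ha]

lemma levelEisenstein_neg {b : ZMod p} (hb : b ≠ 0) (τ : ℍ) :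
    levelEisenstein (-b) τ = -levelEisenstein b τ := by
  have hq0 := nome_ne_zero τ
  have hq1 := norm_nome_lt_one τ
  have hp : (p : ℂ) ≠ 0 := by exact_mod_cast NeZero.ne p
  rw [levelEisenstein_eq_kroneckerSeries hb, levelEisenstein_eq_kroneckerSeries (neg_ne_zero.mpr hb),
    ZMod.neg_val, if_neg hb, pow_sub₀ _ hq0 b.val_lt.le, ← div_eq_mul_inv,
    kroneckerSeries_div (pow_ne_zero p hq0) (norm_pow_lt_one hq1 (val_pos_of_ne_zero hb))
      (norm_pow_lt_norm_pow hq0 hq1 b.val_lt), Nat.cast_sub b.val_lt.le]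
  field_simp
  ring

-- Projecting onto odd characters antisymmetrizes the orthogonality relation.
open scoped Classical in
lemma sum_odd_dirichletCharacter (x : ZMod p) :
    ∑ χ : DirichletCharacter ℂ p with χ.Odd, χ x =
      p.totient / 2 * ((if x = 1 then 1 else 0) - if -x = 1 then 1 else 0) := by
  have h (χ : DirichletCharacter ℂ p) : (if χ.Odd then χ x else 0) = (χ x - χ (-x)) / 2 := by
    split_ifs with hχ
    · rw [hχ.eval_neg]
      ring
    · rw [(χ.even_or_odd.resolve_right hχ).eval_neg, sub_self, zero_div]
  rw [Finset.sum_filter, Finset.sum_congr rfl fun χ _ ↦ h χ, ← Finset.sum_div,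
    Finset.sum_sub_distrib, sum_characters_eq, sum_characters_eq]
  split_ifs <;> ring

/-- Fourier inversion over the odd characters: the Eisenstein series attached to residue classes
in terms of the diamond translates of `eisensteinSum p`. -/
theorem levelEisenstein_eq_sum_oddEisenstein (hp : p.Prime) {b k : ZMod p} (hbk : b * k = 1)
    (τ : ℍ) : levelEisenstein b τ =
      1 / 2 * ∑ c : ZMod p, (1 / 2 - c.val / p) * oddEisenstein τ (c * k) := by
  classical
  have := Fact.mk hp
  have hb : b ≠ 0 := left_ne_zero_of_mul_eq_one hbk
  have hp1 : (p : ℂ) - 1 ≠ 0 := by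
    rw [sub_ne_zero]
    exact_mod_cast hp.ne_one
  have hk (x : ZMod p) : x * k = 1 ↔ x = b :=
    ⟨fun h ↦ mul_right_cancel₀ (right_ne_zero_of_mul_eq_one hbk) (h.trans hbk.symm),
      fun h ↦ h ▸ hbk⟩
  -- Orthogonality selects the classes b and -b, which contribute equally since both the kernel and
  -- the Eisenstein series are odd. Inserting the finite formula for L(0, χ) then produces the
  -- coefficients 1/2 - c/p.
  calc levelEisenstein b τ
      = 1 / (p - 1) * ∑ b' : ZMod p, levelEisenstein b' τ *
          ∑ χ : DirichletCharacter ℂ p with χ.Odd, χ (b' * k) := by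
        simp only [sum_odd_dirichletCharacter, Nat.totient_prime hp, ← neg_mul, hk,
          neg_eq_iff_eq_neg]
        simp only [mul_sub, Finset.sum_sub_distrib, mul_ite, mul_one, mul_zero,
          Finset.sum_ite_eq', Finset.mem_univ, if_true]
        rw [levelEisenstein_neg hb, Nat.cast_sub hp.one_le]
        field_simp
        push_cast
        ring
    _ = 1 / (p - 1) * ∑ χ : DirichletCharacter ℂ p with χ.Odd,
          χ k * (χ.LFunction 0 * heckeEisenstein 1 χ τ) := by
        congr 1
        simp only [Finset.mul_sum]
        rw [Finset.sum_comm]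
        refine Finset.sum_congr rfl fun χ hχ ↦ ?_
        simp only [Finset.mem_filter, Finset.mem_univ, true_and] at hχ
        rw [LFunction_zero_mul_heckeEisenstein hχ hp.ne_one (LFunction_apply_zero_ne_zero hp hχ),
          Finset.mul_sum]
        refine Finset.sum_congr rfl fun b' _ ↦ ?_
        rw [map_mul]
        ring
    _ = _ := by
        simp only [oddEisenstein, Finset.mul_sum]
        rw [Finset.sum_comm]
        refine Finset.sum_congr rfl fun χ hχ ↦ ?_
        simp only [Finset.mem_filter, Finset.mem_univ, true_and] at hχ
        rw [LFunction_apply_zero hχ.ne_one hp.ne_one, Finset.sum_mul, Finset.mul_sum,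
          Finset.mul_sum]
        refine Finset.sum_congr rfl fun c _ ↦ ?_
        rw [map_mul]
        field_simp

end OddEisenstein

/-! ### The addition law for residue classes. -/

section ThreeTerm

open Complex
open UpperHalfPlane hiding I

variable {p : ℕ} [NeZero p]

/-- The correction terms in the three-term relation between the Eisenstein series attached to
residue classes. -/
noncomputable def levelWeierstrass (b : ZMod p) (τ : ℍ) : ℂ :=
  weierstrassSeries (nome τ ^ p) (nome τ ^ b.val) + b.val / p * levelEisenstein b τ
    + b.val ^ 2 / (2 * p ^ 2)

/-- The linear and quadratic terms in b/p compensate the defect in `weierstrassSeries_div`; evenness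
allows the correction terms to be eliminated between different relations. -/
lemma levelWeierstrass_neg {b : ZMod p} (hb : b ≠ 0) (τ : ℍ) :
    levelWeierstrass (-b) τ = levelWeierstrass b τ := by
  have hq0 := nome_ne_zero τ
  have hq1 := norm_nome_lt_one τ
  have hp : (p : ℂ) ≠ 0 := by exact_mod_cast NeZero.ne p
  rw [levelWeierstrass, levelWeierstrass, levelEisenstein_neg hb,
    levelEisenstein_eq_kroneckerSeries hb, ZMod.neg_val, if_neg hb,
    pow_sub₀ _ hq0 b.val_lt.le, ← div_eq_mul_inv,
    weierstrassSeries_div (pow_ne_zero p hq0) (norm_pow_lt_one hq1 (val_pos_of_ne_zero hb))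
      (norm_pow_lt_norm_pow hq0 hq1 b.val_lt), Nat.cast_sub b.val_lt.le]
  field_simp
  ring

/-- The three-term relation between the Eisenstein series attached to residue classes. -/
theorem levelEisenstein_threeTerm {a b : ZMod p} (ha : a ≠ 0) (hb : b ≠ 0)
    (hab : a.val + b.val < p) (τ : ℍ) :
    levelEisenstein a τ * levelEisenstein b τ
        - levelEisenstein (a + b) τ * (levelEisenstein a τ + levelEisenstein b τ) =
      levelWeierstrass a τ + levelWeierstrass b τ + levelWeierstrass (a + b) τ := by
  have hq0 := nome_ne_zero τ
  have hq1 := norm_nome_lt_one τ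
  have hp : (p : ℂ) ≠ 0 := by exact_mod_cast NeZero.ne p
  have hv : (a + b).val = a.val + b.val := ZMod.val_add_of_lt hab
  have hc : a + b ≠ 0 := by
    rw [← ZMod.val_ne_zero, hv]
    have := val_pos_of_ne_zero ha
    omega
  have h := kroneckerSeries_threeTerm (pow_ne_zero p hq0)
    (norm_pow_lt_one hq1 (val_pos_of_ne_zero ha)) (norm_pow_lt_one hq1 (val_pos_of_ne_zero hb))
    (by rw [← pow_add]; exact norm_pow_lt_norm_pow hq0 hq1 hab)
  rw [← pow_add] at h
  simp only [levelWeierstrass, levelEisenstein_eq_kroneckerSeries ha,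
    levelEisenstein_eq_kroneckerSeries hb, levelEisenstein_eq_kroneckerSeries hc, hv]
  push_cast
  field_simp
  -- Writing each Kronecker series as s + r with r = b/p, additive because the representatives do
  -- not wrap around, leaves r_a r_b - r_{a+b}² = -(r_a² + r_b² + r_{a+b}²)/2. This is the source of
  -- the quadratic term in `levelWeierstrass`.
  linear_combination 2 * (p : ℂ) ^ 2 * h

end ThreeTerm

/-! ### Linear algebra at levels 13, 17 and 19. -/

section Relations

/-- The relations satisfied by the diamond translates `g n` of the normalized Eisenstein series of
prime level `p`, together with the Eisenstein series `s n` attached to residue classes and the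
correction terms `w n` of the three-term relation. -/
structure EisensteinRelations (p : ℕ) (g s w : ℕ → ℂ) : Prop where
  g_zero : g 0 = 0
  g_sub : ∀ n ≤ p, g (p - n) = -g n
  -- The class 0 is excluded: theta vanishes there, and division by zero gives a value that is not
  -- odd.
  s_sub : ∀ n < p, 0 < n → s (p - n) = -s n
  w_sub : ∀ n < p, 0 < n → w (p - n) = w n
  fourier : ∀ b k, b * k % p = 1 →
    s b = 1 / 2 * ∑ n ∈ Finset.range p, (1 / 2 - (n : ℂ) / p) * g (n * k % p)
  threeTerm : ∀ a b, 0 < a → 0 < b → a + b < p →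
    s a * s b - s (a + b) * (s a + s b) = w a + w b + w (a + b)

/-- The multipliers of the three-term relations are chosen so that every w cancels after folding by
evenness, and so that the remaining quadratic form in the s becomes the desired one in the g. The
same scheme serves the other two levels. -/
theorem EisensteinRelations.level_13 {g s w : ℕ → ℂ} (H : EisensteinRelations 13 g s w) :
    (g 1 * g 3 + g 2 * g 3 - g 1 * g 5 - g 1 * g 7 - g 2 * g 7 - g 5 * g 7 = 0) ∧ (g 1 * g 4 - g 1
    * g 5 + g 3 * g 7 + g 4 * g 7 - g 5 * g 7 = 0) ∧ (g 3 * g 5 - g 1 * g 7 - g 3 * g 7 = 0) := by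
  have t (a b : ℕ) (h : 0 < a ∧ 0 < b ∧ a + b < 13 := by norm_num) :=
    H.threeTerm a b h.1 h.2.1 h.2.2
  have g7 : g 7 = -g 6 := H.g_sub 6 (by norm_num)
  have g8 : g 8 = -g 5 := H.g_sub 5 (by norm_num)
  have g9 : g 9 = -g 4 := H.g_sub 4 (by norm_num)
  have g10 : g 10 = -g 3 := H.g_sub 3 (by norm_num)
  have g11 : g 11 = -g 2 := H.g_sub 2 (by norm_num)
  have g12 : g 12 = -g 1 := H.g_sub 1 (by norm_num)
  have s7 : s 7 = -s 6 := H.s_sub 6 (by norm_num) (by norm_num)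
  have w7 : w 7 = w 6 := H.w_sub 6 (by norm_num) (by norm_num)
  have s8 : s 8 = -s 5 := H.s_sub 5 (by norm_num) (by norm_num)
  have w8 : w 8 = w 5 := H.w_sub 5 (by norm_num) (by norm_num)
  have s9 : s 9 = -s 4 := H.s_sub 4 (by norm_num) (by norm_num)
  have w9 : w 9 = w 4 := H.w_sub 4 (by norm_num) (by norm_num)
  have s10 : s 10 = -s 3 := H.s_sub 3 (by norm_num) (by norm_num)
  have w10 : w 10 = w 3 := H.w_sub 3 (by norm_num) (by norm_num)
  have s11 : s 11 = -s 2 := H.s_sub 2 (by norm_num) (by norm_num)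
  have w11 : w 11 = w 2 := H.w_sub 2 (by norm_num) (by norm_num)
  have s12 : s 12 = -s 1 := H.s_sub 1 (by norm_num) (by norm_num)
  have w12 : w 12 = w 1 := H.w_sub 1 (by norm_num) (by norm_num)
  -- The second argument is the inverse of the first modulo the level.
  have s1 := H.fourier 1 1 rfl
  have s2 := H.fourier 2 7 rfl
  have s3 := H.fourier 3 9 rfl
  have s4 := H.fourier 4 10 rfl
  have s5 := H.fourier 5 8 rfl
  have s6 := H.fourier 6 11 rfl
  norm_num [Finset.sum_range_succ, H.g_zero, g12, g11, g10, g9, g8, g7]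
    at s1 s2 s3 s4 s5 s6
  refine ⟨?_, ?_, ?_⟩
  -- Normalization is postponed: indices beyond half the level are first folded by parity and the s
  -- replaced by their Fourier expansions, after which the identity is polynomial in independent
  -- symbols.
  · linear_combination (norm := skip) t 1 3 - t 1 4 + t 1 5 - t 1 6 - t 2 3 + t 2 5
    norm_num only [g12, g11, g10, g9, g8, g7, 
      s12, s11, s10, s9, s8, s7, w12, w11, w10, w9, w8, w7]
    simp only [s1, s2, s3, s4, s5, s6]
    ring
  · linear_combination (norm := skip) t 1 2 - t 1 3 - t 2 3 + t 3 3 - t 3 4 + t 4 4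
    norm_num only [g12, g11, g10, g9, g8, g7, 
      s12, s11, s10, s9, s8, s7, w12, w11, w10, w9, w8, w7]
    simp only [s1, s2, s3, s4, s5, s6]
    ring
  · linear_combination (norm := skip) t 1 1 - t 1 2 - t 1 4 + t 2 4 - t 2 5 + t 3 5
    norm_num only [g12, g11, g10, g9, g8, g7, 
      s12, s11, s10, s9, s8, s7, w12, w11, w10, w9, w8, w7]
    simp only [s1, s2, s3, s4, s5, s6]
    ring

theorem EisensteinRelations.level_17 {g s w : ℕ → ℂ} (H : EisensteinRelations 17 g s w) :
    (-3 * g 2 * g 3 + 2 * g 7 * g 3 + 3 * g 13 * g 3 + g 2 * g 7 + g 2 * g 8 + 3 * g 2 * g 11 - 3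
    * g 5 * g 11 + 3 * g 7 * g 11 - g 2 * g 13 - 3 * g 7 * g 13 - 3 * g 11 * g 13 = 0) ∧ (-9 * g 2
    * g 3 + 5 * g 7 * g 3 + 9 * g 13 * g 3 - 5 * g 2 * g 7 - 5 * g 2 * g 8 + 9 * g 1 * g 11 + 9 *
    g 2 * g 11 + 9 * g 7 * g 11 + 5 * g 2 * g 13 - 9 * g 11 * g 13 = 0) ∧ (-3 * g 1 * g 5 - 3 * g
    7 * g 5 + 3 * g 1 * g 7 + g 2 * g 7 + 2 * g 3 * g 7 + g 2 * g 8 - 3 * g 2 * g 11 - 3 * g 7 * g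
    11 + 2 * g 2 * g 13 = 0) ∧ (-9 * g 2 * g 3 + 7 * g 7 * g 3 + 9 * g 8 * g 3 + 2 * g 2 * g 7 + 2
    * g 2 * g 8 + 9 * g 7 * g 11 + 7 * g 2 * g 13 - 9 * g 7 * g 13 = 0) ∧ (16 * g 2 * g 7 - 16 * g
    3 * g 7 + 9 * g 8 * g 7 + 9 * g 1 * g 8 + 16 * g 2 * g 8 - 9 * g 2 * g 11 - 7 * g 2 * g 13 =
    0) ∧ (g 2 * g 7 - 3 * g 3 * g 5 + 2 * g 3 * g 7 + g 2 * g 8 - g 2 * g 13 - 3 * g 7 * g 13 = 0) := by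
  have t (a b : ℕ) (h : 0 < a ∧ 0 < b ∧ a + b < 17 := by norm_num) :=
    H.threeTerm a b h.1 h.2.1 h.2.2
  have g9 : g 9 = -g 8 := H.g_sub 8 (by norm_num)
  have g10 : g 10 = -g 7 := H.g_sub 7 (by norm_num)
  have g11 : g 11 = -g 6 := H.g_sub 6 (by norm_num)
  have g12 : g 12 = -g 5 := H.g_sub 5 (by norm_num)
  have g13 : g 13 = -g 4 := H.g_sub 4 (by norm_num)
  have g14 : g 14 = -g 3 := H.g_sub 3 (by norm_num)
  have g15 : g 15 = -g 2 := H.g_sub 2 (by norm_num)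
  have g16 : g 16 = -g 1 := H.g_sub 1 (by norm_num)
  have s9 : s 9 = -s 8 := H.s_sub 8 (by norm_num) (by norm_num)
  have w9 : w 9 = w 8 := H.w_sub 8 (by norm_num) (by norm_num)
  have s10 : s 10 = -s 7 := H.s_sub 7 (by norm_num) (by norm_num)
  have w10 : w 10 = w 7 := H.w_sub 7 (by norm_num) (by norm_num)
  have s11 : s 11 = -s 6 := H.s_sub 6 (by norm_num) (by norm_num)
  have w11 : w 11 = w 6 := H.w_sub 6 (by norm_num) (by norm_num)
  have s12 : s 12 = -s 5 := H.s_sub 5 (by norm_num) (by norm_num)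
  have w12 : w 12 = w 5 := H.w_sub 5 (by norm_num) (by norm_num)
  have s13 : s 13 = -s 4 := H.s_sub 4 (by norm_num) (by norm_num)
  have w13 : w 13 = w 4 := H.w_sub 4 (by norm_num) (by norm_num)
  have s14 : s 14 = -s 3 := H.s_sub 3 (by norm_num) (by norm_num)
  have w14 : w 14 = w 3 := H.w_sub 3 (by norm_num) (by norm_num)
  have s15 : s 15 = -s 2 := H.s_sub 2 (by norm_num) (by norm_num)
  have w15 : w 15 = w 2 := H.w_sub 2 (by norm_num) (by norm_num)
  have s16 : s 16 = -s 1 := H.s_sub 1 (by norm_num) (by norm_num)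
  have w16 : w 16 = w 1 := H.w_sub 1 (by norm_num) (by norm_num)
  have s1 := H.fourier 1 1 rfl
  have s2 := H.fourier 2 9 rfl
  have s3 := H.fourier 3 6 rfl
  have s4 := H.fourier 4 13 rfl
  have s5 := H.fourier 5 7 rfl
  have s6 := H.fourier 6 3 rfl
  have s7 := H.fourier 7 5 rfl
  have s8 := H.fourier 8 15 rfl
  norm_num [Finset.sum_range_succ, H.g_zero, g16, g15, g14, g13, g12, g11, g10, g9]
    at s1 s2 s3 s4 s5 s6 s7 s8
  refine ⟨?_, ?_, ?_, ?_, ?_, ?_⟩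
  · linear_combination (norm := skip) -3 * t 1 4 + t 1 5 + 2 * t 1 8 + 3 * t 2 3 - t 2 4 + 3 * t 2 5 - 3 * t 2 6 - 2 * t 2 7 - 3
      * t 3 4 + 3 * t 4 4 - 2 * t 4 5 + 3 * t 4 6 - t 5 5
    norm_num only [g16, g15, g14, g13, g12, g11, g10, g9, 
      s16, s15, s14, s13, s12, s11, s10, s9, w16, w15, w14, w13, w12, w11, w10, w9]
    simp only [s1, s2, s3, s4, s5, s6, s7, s8]
    ring
  · linear_combination (norm := skip) -9 * t 1 1 + 9 * t 1 3 + 4 * t 1 5 - 9 * t 1 6 + 14 * t 1 8 + 5 * t 2 4 + 9 * t 2 5 - 5 *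
      t 2 7 - 9 * t 3 5 - 14 * t 4 5 + 5 * t 5 5
    norm_num only [g16, g15, g14, g13, g12, g11, g10, g9, 
      s16, s15, s14, s13, s12, s11, s10, s9, w16, w15, w14, w13, w12, w11, w10, w9]
    simp only [s1, s2, s3, s4, s5, s6, s7, s8]
    ring
  · linear_combination (norm := skip) -3 * t 1 2 + 3 * t 1 3 + 3 * t 1 4 - 2 * t 1 5 - t 1 8 - 3 * t 2 3 - t 2 4 + 3 * t 2 5 + 4
      * t 2 7 + 3 * t 3 3 - 3 * t 3 5 + 3 * t 3 6 - 3 * t 3 7 - 2 * t 4 5 - 3 * t 4 6 + 2 * t 5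
      5
    norm_num only [g16, g15, g14, g13, g12, g11, g10, g9, 
      s16, s15, s14, s13, s12, s11, s10, s9, w16, w15, w14, w13, w12, w11, w10, w9]
    simp only [s1, s2, s3, s4, s5, s6, s7, s8]
    ring
  · linear_combination (norm := skip) 9 * t 1 3 - 9 * t 1 4 + 2 * t 1 5 - 9 * t 1 6 + 7 * t 1 8 - 9 * t 2 2 + 9 * t 2 3 - 2 * t
      2 4 + 9 * t 2 5 + 2 * t 2 7 - 9 * t 3 5 - 9 * t 3 6 + 9 * t 4 4 - 7 * t 4 5 - 2 * t 5 5 +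
      9 * t 5 6
    norm_num only [g16, g15, g14, g13, g12, g11, g10, g9, 
      s16, s15, s14, s13, s12, s11, s10, s9, w16, w15, w14, w13, w12, w11, w10, w9]
    simp only [s1, s2, s3, s4, s5, s6, s7, s8]
    ring
  · linear_combination (norm := skip) -9 * t 1 2 + 9 * t 1 3 + 9 * t 1 4 + 16 * t 1 5 - 9 * t 1 6 - 16 * t 1 8 - 9 * t 2 3 - 16
      * t 2 4 + 9 * t 2 6 + 25 * t 2 7 + 9 * t 3 3 - 9 * t 3 5 + 7 * t 4 5 - 9 * t 4 6 - 7 * t 5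
      5
    norm_num only [g16, g15, g14, g13, g12, g11, g10, g9, 
      s16, s15, s14, s13, s12, s11, s10, s9, w16, w15, w14, w13, w12, w11, w10, w9]
    simp only [s1, s2, s3, s4, s5, s6, s7, s8]
    ring
  · linear_combination (norm := skip) -3 * t 1 4 + t 1 5 + 3 * t 1 6 - t 1 8 + 3 * t 2 3 - t 2 4 - 3 * t 2 6 + t 2 7 - 3 * t 3 4
      + 3 * t 4 4 + t 4 5 - t 5 5
    norm_num only [g16, g15, g14, g13, g12, g11, g10, g9, 
      s16, s15, s14, s13, s12, s11, s10, s9, w16, w15, w14, w13, w12, w11, w10, w9]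
    simp only [s1, s2, s3, s4, s5, s6, s7, s8]
    ring

set_option maxHeartbeats 800000 in
theorem EisensteinRelations.level_19 {g s w : ℕ → ℂ} (H : EisensteinRelations 19 g s w) :
    (g 2 * g 5 - g 4 * g 5 + g 7 * g 5 - 3 * g 9 * g 5 + g 11 * g 5 + g 13 * g 5 + g 7 * g 9 - g 7
    * g 11 - g 2 * g 13 - g 3 * g 13 + g 9 * g 13 - g 11 * g 13 = 0) ∧ (-g 1 * g 5 + g 2 * g 5 + g
    3 * g 5 - g 4 * g 5 + g 7 * g 5 - g 11 * g 5 - g 13 * g 5 + g 1 * g 7 - g 2 * g 13 - g 3 * g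
    13 + g 11 * g 13 = 0) ∧ (-g 2 * g 5 - g 3 * g 5 + g 7 * g 5 - g 9 * g 5 + g 11 * g 5 + g 13 *
    g 5 + g 2 * g 7 - g 7 * g 11 + g 2 * g 13 - g 11 * g 13 = 0) ∧ (g 2 * g 5 + g 3 * g 5 - g 7 *
    g 5 - g 11 * g 5 - g 13 * g 5 + g 3 * g 11 - g 2 * g 13 - g 3 * g 13 + g 11 * g 13 = 0) ∧ (-g
    2 * g 5 - g 3 * g 5 + g 7 * g 5 + g 9 * g 5 + g 13 * g 5 + g 2 * g 11 + g 3 * g 13 - g 11 * g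
    13 = 0) ∧ (-g 2 * g 5 - g 3 * g 5 + g 4 * g 5 + g 9 * g 5 + g 1 * g 9 + g 2 * g 13 + g 3 * g
    13 = 0) ∧ (-g 2 * g 3 + g 5 * g 3 + g 9 * g 3 + g 2 * g 5 - g 4 * g 5 - g 2 * g 13 = 0) ∧ (-g
    3 * g 5 - g 9 * g 5 + g 13 * g 5 + g 1 * g 13 + g 3 * g 13 = 0) ∧ (g 3 * g 5 - g 4 * g 5 + g 4
    * g 11 - g 3 * g 13 = 0) ∧ (g 2 * g 4 - g 5 * g 9 - g 3 * g 13 = 0) := by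
  have t (a b : ℕ) (h : 0 < a ∧ 0 < b ∧ a + b < 19 := by norm_num) :=
    H.threeTerm a b h.1 h.2.1 h.2.2
  have g10 : g 10 = -g 9 := H.g_sub 9 (by norm_num)
  have g11 : g 11 = -g 8 := H.g_sub 8 (by norm_num)
  have g12 : g 12 = -g 7 := H.g_sub 7 (by norm_num)
  have g13 : g 13 = -g 6 := H.g_sub 6 (by norm_num)
  have g14 : g 14 = -g 5 := H.g_sub 5 (by norm_num)
  have g15 : g 15 = -g 4 := H.g_sub 4 (by norm_num)
  have g16 : g 16 = -g 3 := H.g_sub 3 (by norm_num)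
  have g17 : g 17 = -g 2 := H.g_sub 2 (by norm_num)
  have g18 : g 18 = -g 1 := H.g_sub 1 (by norm_num)
  have s10 : s 10 = -s 9 := H.s_sub 9 (by norm_num) (by norm_num)
  have w10 : w 10 = w 9 := H.w_sub 9 (by norm_num) (by norm_num)
  have s11 : s 11 = -s 8 := H.s_sub 8 (by norm_num) (by norm_num)
  have w11 : w 11 = w 8 := H.w_sub 8 (by norm_num) (by norm_num)
  have s12 : s 12 = -s 7 := H.s_sub 7 (by norm_num) (by norm_num)
  have w12 : w 12 = w 7 := H.w_sub 7 (by norm_num) (by norm_num)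
  have s13 : s 13 = -s 6 := H.s_sub 6 (by norm_num) (by norm_num)
  have w13 : w 13 = w 6 := H.w_sub 6 (by norm_num) (by norm_num)
  have s14 : s 14 = -s 5 := H.s_sub 5 (by norm_num) (by norm_num)
  have w14 : w 14 = w 5 := H.w_sub 5 (by norm_num) (by norm_num)
  have s15 : s 15 = -s 4 := H.s_sub 4 (by norm_num) (by norm_num)
  have w15 : w 15 = w 4 := H.w_sub 4 (by norm_num) (by norm_num)
  have s16 : s 16 = -s 3 := H.s_sub 3 (by norm_num) (by norm_num)
  have w16 : w 16 = w 3 := H.w_sub 3 (by norm_num) (by norm_num)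
  have s17 : s 17 = -s 2 := H.s_sub 2 (by norm_num) (by norm_num)
  have w17 : w 17 = w 2 := H.w_sub 2 (by norm_num) (by norm_num)
  have s18 : s 18 = -s 1 := H.s_sub 1 (by norm_num) (by norm_num)
  have w18 : w 18 = w 1 := H.w_sub 1 (by norm_num) (by norm_num)
  have s1 := H.fourier 1 1 rfl
  have s2 := H.fourier 2 10 rfl
  have s3 := H.fourier 3 13 rfl
  have s4 := H.fourier 4 5 rfl
  have s5 := H.fourier 5 4 rfl
  have s6 := H.fourier 6 16 rfl
  have s7 := H.fourier 7 11 rfl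
  have s8 := H.fourier 8 12 rfl
  have s9 := H.fourier 9 17 rfl
  norm_num [Finset.sum_range_succ, H.g_zero, g18, g17, g16, g15, g14, g13, g12, g11, g10]
    at s1 s2 s3 s4 s5 s6 s7 s8 s9
  refine ⟨?_, ?_, ?_, ?_, ?_, ?_, ?_, ?_, ?_, ?_⟩
  · linear_combination (norm := skip) t 1 3 + 2 * t 1 4 - t 1 5 - t 1 7 - t 1 9 - t 2 2 - 2 * t 2 3 + t 2 4 + t 2 6 + t 2 7 + t
      2 8 + t 3 5 - t 3 6 + t 3 7 - t 4 4 + t 4 6 - 2 * t 4 7 - t 5 5 + t 5 6 + t 5 7 - t 6 6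
    norm_num only [g18, g17, g16, g15, g14, g13, g12, g11, g10, 
      s18, s17, s16, s15, s14, s13, s12, s11, s10, w18, w17, w16, w15, w14, w13, w12, w11, w10]
    simp only [s1, s2, s3, s4, s5, s6, s7, s8, s9]
    ring
  · linear_combination (norm := skip) t 1 1 - t 1 2 + 2 * t 1 4 - t 1 6 - t 1 7 - t 1 9 - t 2 3 - t 2 5 + t 2 6 + t 2 7 - t 3 3
      + t 3 4 + t 3 5 + 2 * t 3 7 - t 4 4 - t 4 7 - t 5 5 + t 5 6
    norm_num only [g18, g17, g16, g15, g14, g13, g12, g11, g10, 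
      s18, s17, s16, s15, s14, s13, s12, s11, s10, w18, w17, w16, w15, w14, w13, w12, w11, w10]
    simp only [s1, s2, s3, s4, s5, s6, s7, s8, s9]
    ring
  · linear_combination (norm := skip) -t 1 5 + t 1 6 + t 3 3 - t 3 4 - t 3 7 + t 4 6 + t 5 7 - t 6 6
    norm_num only [g18, g17, g16, g15, g14, g13, g12, g11, g10, 
      s18, s17, s16, s15, s14, s13, s12, s11, s10, w18, w17, w16, w15, w14, w13, w12, w11, w10]
    simp only [s1, s3, s4, s5, s6, s7, s9]
    ring
  · linear_combination (norm := skip) t 1 4 + t 1 5 - t 1 6 - t 1 9 - t 2 3 - t 2 5 + t 2 6 + t 2 8 - t 3 3 + 2 * t 3 4 + 2 * t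
      3 7 - t 3 8 - t 4 4 - t 4 6 + t 5 6 - t 5 7
    norm_num only [g18, g17, g16, g15, g14, g13, g12, g11, g10, 
      s18, s17, s16, s15, s14, s13, s12, s11, s10, w18, w17, w16, w15, w14, w13, w12, w11, w10]
    simp only [s1, s2, s3, s4, s5, s6, s7, s8, s9]
    ring
  · linear_combination (norm := skip) -t 1 4 + t 1 6 - t 1 8 + t 1 9 + t 2 3 - t 2 6 + t 2 7 - t 2 8 - t 3 4 - t 3 7 + t 3 8 + t
      4 4
    norm_num only [g18, g17, g16, g15, g14, g13, g12, g11, g10, 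
      s18, s17, s16, s15, s14, s13, s12, s11, s10, w18, w17, w16, w15, w14, w13, w12, w11, w10]
    simp only [s1, s2, s3, s4, s5, s6, s7, s8, s9]
    ring
  · linear_combination (norm := skip) -t 1 3 - 2 * t 1 4 + t 1 6 + t 1 7 + t 1 9 + t 2 2 + t 2 3 - t 2 6 - t 2 7 - t 2 8 + t 3 3
      - t 3 4 - t 3 7 + t 4 4 + t 4 7 + t 5 5 - t 5 6
    norm_num only [g18, g17, g16, g15, g14, g13, g12, g11, g10, 
      s18, s17, s16, s15, s14, s13, s12, s11, s10, w18, w17, w16, w15, w14, w13, w12, w11, w10]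
    simp only [s1, s2, s3, s4, s5, s6, s7, s8, s9]
    ring
  · linear_combination (norm := skip) t 1 3 + t 1 4 + t 1 5 - t 1 6 - t 1 7 - t 1 8 - t 2 2 - t 2 3 + t 2 6 + t 2 7 + t 2 8 - t
      3 3 + t 3 4 + t 3 7 - t 4 6 - t 4 7 - t 5 5 + t 5 6
    norm_num only [g18, g17, g16, g15, g14, g13, g12, g11, g10, 
      s18, s17, s16, s15, s14, s13, s12, s11, s10, w18, w17, w16, w15, w14, w13, w12, w11, w10]
    simp only [s1, s2, s3, s4, s5, s6, s7, s8, s9]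
    ring
  · linear_combination (norm := skip) -t 1 1 + t 1 3 + t 1 6 + t 2 8 - t 3 6 - t 4 7
    norm_num only [g18, g17, g16, g15, g14, g13, g12, g11, g10, 
      s18, s17, s16, s15, s14, s13, s12, s11, s10, w18, w17, w16, w15, w14, w13, w12, w11, w10]
    simp only [s1, s2, s3, s4, s6, s7, s8, s9]
    ring
  · linear_combination (norm := skip) t 1 4 - t 1 6 - t 2 3 + t 2 6 + t 3 4 - t 4 4
    norm_num only [g18, g17, g16, g15, g14, g13, g12, g11, g10, 
      s18, s17, s16, s15, s14, s13, s12, s11, s10, w18, w17, w16, w15, w14, w13, w12, w11, w10]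
    simp only [s1, s2, s3, s4, s5, s6, s7, s8]
    ring
  · linear_combination (norm := skip) t 1 4 - t 1 9 - t 2 3 + t 2 6 + t 3 7 - t 4 4 + t 4 6 - t 6 6
    norm_num only [g18, g17, g16, g15, g14, g13, g12, g11, g10, 
      s18, s17, s16, s15, s14, s13, s12, s11, s10, w18, w17, w16, w15, w14, w13, w12, w11, w10]
    simp only [s1, s2, s3, s4, s5, s6, s7, s8, s9]
    ring

end Relations

/-! ### The Eisenstein series satisfy the abstract relations; conclusion. -/

section
open UpperHalfPlane

theorem eisensteinRelations {p : ℕ} [NeZero p] (hp : p.Prime) (τ : ℍ) :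
    EisensteinRelations p (fun n ↦ oddEisenstein τ (n : ZMod p))
      (fun n ↦ levelEisenstein (n : ZMod p) τ) (fun n ↦ levelWeierstrass (n : ZMod p) τ) := by
  have hcast {n : ℕ} (h : n ≤ p) : ((p - n : ℕ) : ZMod p) = -n := by
    rw [Nat.cast_sub h, CharP.cast_eq_zero, zero_sub]
  have hne {n : ℕ} (h1 : 0 < n) (h2 : n < p) : (n : ZMod p) ≠ 0 := by
    rw [ne_eq, ZMod.natCast_eq_zero_iff]
    exact Nat.not_dvd_of_pos_of_lt h1 h2
  refine ⟨?_, fun n hn ↦ ?_, fun n hn h0 ↦ ?_, fun n hn h0 ↦ ?_, fun b k hbk ↦ ?_,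
    fun a b ha hb hab ↦ ?_⟩
  · have h := oddEisenstein_neg (p := p) τ 0
    rw [neg_zero, eq_neg_iff_add_eq_zero, add_self_eq_zero] at h
    rwa [Nat.cast_zero]
  · rw [hcast hn, oddEisenstein_neg]
  · rw [hcast hn.le, levelEisenstein_neg (hne h0 hn)]
  · rw [hcast hn.le, levelWeierstrass_neg (hne h0 hn)]
  · have h1 : (b : ZMod p) * k = 1 := by
      rw [← Nat.cast_mul, ← ZMod.natCast_mod, hbk, Nat.cast_one]
    rw [levelEisenstein_eq_sum_oddEisenstein hp h1, ZMod.sum_eq_sum_range]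
    congr 1
    refine Finset.sum_congr rfl fun n hn ↦ ?_
    rw [ZMod.val_cast_of_lt (Finset.mem_range.mp hn), ZMod.natCast_mod, Nat.cast_mul]
  · have h := levelEisenstein_threeTerm (hne ha (by omega)) (hne hb (by omega))
      (by rwa [ZMod.val_cast_of_lt (by omega), ZMod.val_cast_of_lt (by omega)]) τ
    simpa only [Nat.cast_add] using h

end

theorem mainTheorem12 :
    (∀ γ : ℕ → CongruenceSubgroup.Gamma0 13, IsDiamondSystem 13 γ →
      ∀ E : ℕ → UpperHalfPlane → ℂ, E = eisensteinGen γ → ∀ τ : UpperHalfPlane,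
        (E 1 τ * E 3 τ + E 2 τ * E 3 τ - E 1 τ * E 5 τ - E 1 τ * E 7 τ - E 2 τ * E 7 τ
          - E 5 τ * E 7 τ = 0) ∧
        (E 1 τ * E 4 τ - E 1 τ * E 5 τ + E 3 τ * E 7 τ + E 4 τ * E 7 τ - E 5 τ * E 7 τ = 0) ∧
        (E 3 τ * E 5 τ - E 1 τ * E 7 τ - E 3 τ * E 7 τ = 0)) ∧
    (∀ γ : ℕ → CongruenceSubgroup.Gamma0 17, IsDiamondSystem 17 γ →
      ∀ E : ℕ → UpperHalfPlane → ℂ, E = eisensteinGen γ → ∀ τ : UpperHalfPlane,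
        (-3 * E 2 τ * E 3 τ + 2 * E 7 τ * E 3 τ + 3 * E 13 τ * E 3 τ + E 2 τ * E 7 τ
          + E 2 τ * E 8 τ + 3 * E 2 τ * E 11 τ - 3 * E 5 τ * E 11 τ + 3 * E 7 τ * E 11 τ
          - E 2 τ * E 13 τ - 3 * E 7 τ * E 13 τ - 3 * E 11 τ * E 13 τ = 0) ∧
        (-9 * E 2 τ * E 3 τ + 5 * E 7 τ * E 3 τ + 9 * E 13 τ * E 3 τ - 5 * E 2 τ * E 7 τ
          - 5 * E 2 τ * E 8 τ + 9 * E 1 τ * E 11 τ + 9 * E 2 τ * E 11 τ + 9 * E 7 τ * E 11 τ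
          + 5 * E 2 τ * E 13 τ - 9 * E 11 τ * E 13 τ = 0) ∧
        (-3 * E 1 τ * E 5 τ - 3 * E 7 τ * E 5 τ + 3 * E 1 τ * E 7 τ + E 2 τ * E 7 τ
          + 2 * E 3 τ * E 7 τ + E 2 τ * E 8 τ - 3 * E 2 τ * E 11 τ - 3 * E 7 τ * E 11 τ
          + 2 * E 2 τ * E 13 τ = 0) ∧
        (-9 * E 2 τ * E 3 τ + 7 * E 7 τ * E 3 τ + 9 * E 8 τ * E 3 τ + 2 * E 2 τ * E 7 τ
          + 2 * E 2 τ * E 8 τ + 9 * E 7 τ * E 11 τ + 7 * E 2 τ * E 13 τ - 9 * E 7 τ * E 13 τ = 0) ∧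
        (16 * E 2 τ * E 7 τ - 16 * E 3 τ * E 7 τ + 9 * E 8 τ * E 7 τ + 9 * E 1 τ * E 8 τ
          + 16 * E 2 τ * E 8 τ - 9 * E 2 τ * E 11 τ - 7 * E 2 τ * E 13 τ = 0) ∧
        (E 2 τ * E 7 τ - 3 * E 3 τ * E 5 τ + 2 * E 3 τ * E 7 τ + E 2 τ * E 8 τ
          - E 2 τ * E 13 τ - 3 * E 7 τ * E 13 τ = 0)) ∧
    (∀ γ : ℕ → CongruenceSubgroup.Gamma0 19, IsDiamondSystem 19 γ →
      ∀ E : ℕ → UpperHalfPlane → ℂ, E = eisensteinGen γ → ∀ τ : UpperHalfPlane,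
        (E 2 τ * E 5 τ - E 4 τ * E 5 τ + E 7 τ * E 5 τ - 3 * E 9 τ * E 5 τ + E 11 τ * E 5 τ
          + E 13 τ * E 5 τ + E 7 τ * E 9 τ - E 7 τ * E 11 τ - E 2 τ * E 13 τ
          - E 3 τ * E 13 τ + E 9 τ * E 13 τ - E 11 τ * E 13 τ = 0) ∧
        (-E 1 τ * E 5 τ + E 2 τ * E 5 τ + E 3 τ * E 5 τ - E 4 τ * E 5 τ + E 7 τ * E 5 τ
          - E 11 τ * E 5 τ - E 13 τ * E 5 τ + E 1 τ * E 7 τ - E 2 τ * E 13 τ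
          - E 3 τ * E 13 τ + E 11 τ * E 13 τ = 0) ∧
        (-E 2 τ * E 5 τ - E 3 τ * E 5 τ + E 7 τ * E 5 τ - E 9 τ * E 5 τ + E 11 τ * E 5 τ
          + E 13 τ * E 5 τ + E 2 τ * E 7 τ - E 7 τ * E 11 τ + E 2 τ * E 13 τ
          - E 11 τ * E 13 τ = 0) ∧
        (E 2 τ * E 5 τ + E 3 τ * E 5 τ - E 7 τ * E 5 τ - E 11 τ * E 5 τ - E 13 τ * E 5 τ
          + E 3 τ * E 11 τ - E 2 τ * E 13 τ - E 3 τ * E 13 τ + E 11 τ * E 13 τ = 0) ∧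
        (-E 2 τ * E 5 τ - E 3 τ * E 5 τ + E 7 τ * E 5 τ + E 9 τ * E 5 τ + E 13 τ * E 5 τ
          + E 2 τ * E 11 τ + E 3 τ * E 13 τ - E 11 τ * E 13 τ = 0) ∧
        (-E 2 τ * E 5 τ - E 3 τ * E 5 τ + E 4 τ * E 5 τ + E 9 τ * E 5 τ + E 1 τ * E 9 τ
          + E 2 τ * E 13 τ + E 3 τ * E 13 τ = 0) ∧
        (-E 2 τ * E 3 τ + E 5 τ * E 3 τ + E 9 τ * E 3 τ + E 2 τ * E 5 τ - E 4 τ * E 5 τ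
          - E 2 τ * E 13 τ = 0) ∧
        (-E 3 τ * E 5 τ - E 9 τ * E 5 τ + E 13 τ * E 5 τ + E 1 τ * E 13 τ + E 3 τ * E 13 τ = 0) ∧
        (E 3 τ * E 5 τ - E 4 τ * E 5 τ + E 4 τ * E 11 τ - E 3 τ * E 13 τ = 0) ∧
        (E 2 τ * E 4 τ - E 5 τ * E 9 τ - E 3 τ * E 13 τ = 0)) := by
  refine ⟨?_, ?_, ?_⟩
  · rintro γ hγ _ rfl τ
    have hp : Nat.Prime 13 := by norm_num
    have e (a : ℕ) (ha : a.Coprime 13 := by norm_num) := eisensteinGen_eq_oddEisenstein hp hγ ha τ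
    rw [e 1, e 2, e 3, e 4, e 5, e 7]
    exact (eisensteinRelations hp τ).level_13
  · rintro γ hγ _ rfl τ
    have hp : Nat.Prime 17 := by norm_num
    have e (a : ℕ) (ha : a.Coprime 17 := by norm_num) := eisensteinGen_eq_oddEisenstein hp hγ ha τ
    rw [e 1, e 2, e 3, e 5, e 7, e 8, e 11, e 13]
    exact (eisensteinRelations hp τ).level_17
  · rintro γ hγ _ rfl τ
    have hp : Nat.Prime 19 := by norm_num
    have e (a : ℕ) (ha : a.Coprime 19 := by norm_num) := eisensteinGen_eq_oddEisenstein hp hγ ha τ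
    rw [e 1, e 2, e 3, e 4, e 5, e 7, e 9, e 11, e 13]
    exact (eisensteinRelations hp τ).level_19
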